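/- Let $d,m\ge 1$, let $\hat\alpha=(\alpha_1,\dots,\alpha_d)\in(0,1]^d$, let $r_1,\dots,r_m\ge 0$, $r:=\max_{1\le j\le m} r_j$, and let $\tau_j:[0,\infty)\to[0,r_j]$ be continuous, $j=1,\dots,m$. For vectors write $u\succeq w$ (resp. $u\succ w$) if $u_i\ge w_i$ (resp. $u_i>w_i$) for all $i$. Let $f,g^{(1)},\dots,g^{(m)}:\mathbb R^d\to\mathbb R^d$ and consider $$ \begin{cases} {}^{C}\!D^{\hat\alpha}_{0^+}w(t)=f(w(t))+\sum_{j=1}^m g^{(j)}(w(t-\tau_j(t))), & t>0,\\ w(s)=\varphi(s), & s\in[-r,0], \end{cases}\qquad(\ast) $$ where $\big({}^{C}\!D^{\hat\alpha}_{0^+}w\big)_i(t)=\frac{d}{dt}\,I^{1-\alpha_i}_{0^+}(w_i-w_i(0))(t)$ is the Caputo derivative, $I^{a}_{0^+}x(t)=\frac1{\Gamma(a)}\int_0^t(t-s)^{a-1}x(s)\,ds$ for $a>0$ and $I^0_{0^+}x=x$. A solution of $(\ast)$ on $[0,T)$, $0<T\le\infty$, is a continuous function on $[-r,T)$ that equals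 $\varphi$ on $[-r,0]$ and whose Caputo derivatives exist and satisfy the equation at every $t\in(0,T)$. Assume: * **(H1)** $f$ is continuous on $\mathbb R^d$ and continuously differentiable on $\mathbb R^d\setminus\{0\}$; for every $x\succeq 0$, $x\neq0$, the off-diagonal entries of the Jacobian matrix $Df(x)$ are nonnegative; and $f$ is homogeneous of degree $p\ge1$, i.e. $f(\lambda x)=\lambda^p f(x)$ for all $x\in\mathbb R^d$, $\lambda>0$. * **(H2)** For each $j$, $g^{(j)}$ is continuously differentiable on $\mathbb R^d\setminus\{0\}$, is order-preserving on $\mathbb R^d_{\ge0}$ (if $u\succeq w\succeq 0$ then $g^{(j)}(u)\succeq g^{(j)}(w)$), and is homogeneous of degree $q_j\ge p$. * **(S)** $v\succ0$ is a vector with $f(v)+\sum_{j=1}^m g^{(j)}(v)\prec0$. Put $\|w\|_v:=\max_{1\le i\le d}|w_i|/v_i$ for $w\in\mathbb R^d$ and $\|\varphi\|_v:=\sup_{s\in[-r,0]}\|\varphi(s)\|_v$. (i) Suppose that $q_j>p$ for some $j$. Then for every continuous $\varphi:[-r,0]\to\mathbb R^d_{\ge0}$ with $\varphi(0)\succ0$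 and $\|\varphi\|_v<1$, the solution $\Phi(\cdot,\varphi)$ of $(\ast)$ exists globally on $[0,\infty)$, and $\|\Phi(t,\varphi)\|_v\le\|\varphi\|_v$ for all $t\ge0$. (ii) Suppose that $q_j=p$ for all $j$. Then for every continuous $\varphi:[-r,0]\to\mathbb R^d_{\ge0}$ with $\varphi(0)\succ0$, the solution $\Phi(\cdot,\varphi)$ of $(\ast)$ exists globally on $[0,\infty)$, and $\|\Phi(t,\varphi)\|_v\le\|\varphi\|_v$ for all $t\ge0$. Here "the solution exists globally" means that $(\ast)$ has a solution on $[0,\infty)$ and every solution on an interval $[0,T)$, $0<T\le\infty$, is a restriction of it. -/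

import Mathlib

noncomputable section

/-- Riemann–Liouville fractional integral of order `a ≥ 0` started at `0`:
`(1 / Γ(a)) ∫₀ᵗ (t - s)^(a - 1) x(s) ds` for `a > 0`, and the identity operator for `a = 0`. -/
def rlIntegral (a : ℝ) (x : ℝ → ℝ) (t : ℝ) : ℝ :=
  if a = 0 then x t
  else (1 / Real.Gamma a) * ∫ s in (0 : ℝ)..t, (t - s) ^ (a - 1) * x s

/-- The Caputo derivative `d/dt I^(1 - a) (x - x(0))` of order `a ∈ (0, 1]` of `x`
exists at the time `t` and equals `c`. -/
def HasCaputoDerivAt (a : ℝ) (x : ℝ → ℝ) (c t : ℝ) : Prop :=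
  HasDerivAt (rlIntegral (1 - a) (fun s => x s - x 0)) c t

/-- Metzler matrix: the off-diagonal entries are nonnegative. -/
def IsMetzler {d : ℕ} (A : Matrix (Fin d) (Fin d) ℝ) : Prop :=
  ∀ i j, i ≠ j → 0 ≤ A i j

/-- Jacobian matrix `(∂ f_i / ∂ x_j)(x)`. -/
def jacobian {d : ℕ} (f : (Fin d → ℝ) → (Fin d → ℝ)) (x : Fin d → ℝ) :
    Matrix (Fin d) (Fin d) ℝ :=
  Matrix.of fun i j => fderiv ℝ f x (Pi.single j 1) i

/-- Cooperative vector field: continuous on `ℝ^d`, continuously differentiable on `ℝ^d ∖ {0}`,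
with Metzler Jacobian at every nonzero point of the closed nonnegative orthant. -/
structure IsCooperative {d : ℕ} (f : (Fin d → ℝ) → (Fin d → ℝ)) : Prop where
  continuous : Continuous f
  contDiffOn : ContDiffOn ℝ 1 f {0}ᶜ
  metzler : ∀ x : Fin d → ℝ, 0 ≤ x → x ≠ 0 → IsMetzler (jacobian f x)

/-- Homogeneity of degree `p`: `f (c x) = c^p f x` for all `x` and all `c > 0`. -/
def IsHomogeneousOfDegree {d : ℕ} (p : ℝ) (f : (Fin d → ℝ) → (Fin d → ℝ)) : Prop :=
  ∀ (x : Fin d → ℝ) (c : ℝ), 0 < c → f (c • x) = c ^ p • f x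

/-- Order-preserving on the closed nonnegative orthant. -/
def IsOrderPreserving {d : ℕ} (g : (Fin d → ℝ) → (Fin d → ℝ)) : Prop :=
  MonotoneOn g {x | 0 ≤ x}

/-- Weighted norm `max_i |w_i| / v_i` of a vector (for a weight `v` with positive entries). -/
def weightedNorm {d : ℕ} (v w : Fin d → ℝ) : ℝ :=
  ⨆ i, |w i| / v i

/-- Weighted norm of a history: the supremum over `s ∈ [-r, 0]` of the weighted norm of `φ s`. -/
def historyNorm {d : ℕ} (v : Fin d → ℝ) (r : ℝ) (φ : ℝ → Fin d → ℝ) : ℝ :=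
  sSup ((fun s => weightedNorm v (φ s)) '' Set.Icc (-r) 0)

/-- `w` is a solution on `[0, T)`, `T ∈ (0, ∞]`, of the mixed-order delay system
`ᶜD^α w(t) = f (w t) + ∑ⱼ gⱼ (w (t - τⱼ t))` for `0 < t < T`, with `w = φ` on `[-r, 0]`:
it is continuous on `[-r, T)`, and each Caputo derivative exists and has the prescribed value
at every time in `(0, T)`. Values of `w` outside `[-r, T)` play no role. -/
structure IsDelaySolution {d m : ℕ} (α : Fin d → ℝ) (f : (Fin d → ℝ) → (Fin d → ℝ))
    (g : Fin m → (Fin d → ℝ) → (Fin d → ℝ)) (τ : Fin m → ℝ → ℝ) (r : ℝ)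
    (φ : ℝ → Fin d → ℝ) (T : EReal) (w : ℝ → Fin d → ℝ) : Prop where
  continuousOn : ContinuousOn w {t : ℝ | -r ≤ t ∧ (t : EReal) < T}
  history : ∀ s ∈ Set.Icc (-r) 0, w s = φ s
  equation : ∀ t : ℝ, 0 < t → (t : EReal) < T → ∀ i,
    HasCaputoDerivAt (α i) (fun s => w s i)
      (f (w t) i + ∑ j, g j (w (t - τ j t)) i) t

/-- `w` is the unique maximal solution, and its maximal interval of existence is `[0, ∞)`:
it is a solution on `[0, ∞)`, and every solution on some `[0, T)`, `0 < T ≤ ∞`, is a restriction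
of `w`. -/
def IsUniqueGlobalSolution {d m : ℕ} (α : Fin d → ℝ) (f : (Fin d → ℝ) → (Fin d → ℝ))
    (g : Fin m → (Fin d → ℝ) → (Fin d → ℝ)) (τ : Fin m → ℝ → ℝ) (r : ℝ)
    (φ : ℝ → Fin d → ℝ) (w : ℝ → Fin d → ℝ) : Prop :=
  IsDelaySolution α f g τ r φ ⊤ w ∧
    ∀ (T : EReal) (u : ℝ → Fin d → ℝ), 0 < T → IsDelaySolution α f g τ r φ T u →
      ∀ t : ℝ, -r ≤ t → (t : EReal) < T → u t = w t

end

/-! The heart of the matter is invariance of the box `[0, c • v]`, where `c` is the history norm.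
Homogeneity turns the stability condition at `v` into the same condition, non-strictly, at `c • v`:
since `g j v ≥ 0`, it is enough that `c ^ q j ≤ c ^ p`, which holds if `c < 1` and `p ≤ q j`, or if
`q j = p`. Lying in that box is exactly having weighted norm at most `c` and nonnegative
coordinates.

For invariance (`exists_isUniqueGlobalSolution_mem_box`), the fields are composed with the
coordinatewise clamp onto the box. Homogeneous maps of degree at least one that are `C¹` off the
origin are Lipschitz on bounded sets, so the clamped system is bounded and globally Lipschitz, and a
contraction in an exponentially weighted sup norm solves it on all of `[0, ∞)`. Cooperativity and
monotonicity give the sign of the field on the faces: it points up where `w i ≤ 0` and down where `w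
i ≥ c * v i`. A scalar positivity principle, applied to `w i` and to `c * v i - w i`, keeps the
solution in the box, where the clamp is the identity. Uniqueness among all solutions then follows
from the local Lipschitz property.

The positivity principle (`rlIntegral_solution_nonneg`) is delicate because the Caputo derivative is
nonlocal and solutions are merely continuous, so a sign at the first zero is not immediate. The key
is `rlHistory_nonneg`: if `z + I^a h ≥ 0` on `[0, T]`, then the memory of `h` on `[0, s]`, seen from
any later `t ≤ T`, also satisfies `z + memory ≥ 0`. What happens just before the first zero then
decides the sign there.

The passage between Caputo derivatives and Volterra equations rests on `I^a I^(1-a) x = ∫ x`, that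
is, on the Beta integral and associativity of convolution. -/

section FractionalDelay

open MeasureTheory Set Filter Topology

/-! ### Riemann–Liouville integrals: linearity, monotonicity, exponential bounds, continuity. -/

theorem rlIntegral_of_pos {a : ℝ} (ha : 0 < a) (h : ℝ → ℝ) (t : ℝ) :
    rlIntegral a h t = (1 / Real.Gamma a) * ∫ s in (0 : ℝ)..t, (t - s) ^ (a - 1) * h s :=
  if_neg (ne_of_gt ha)

/-- The Riemann–Liouville kernel is integrable up to its singularity. -/
theorem intervalIntegrable_rlKernel {a : ℝ} (ha : 0 < a) (t b c : ℝ) :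
    IntervalIntegrable (fun s => (t - s) ^ (a - 1)) volume b c := by
  have := (intervalIntegral.intervalIntegrable_rpow' (a := t - b) (b := t - c)
    (show -1 < a - 1 by linarith)).comp_sub_left t
  simpa using this

theorem intervalIntegrable_rlKernel_mul {a : ℝ} (ha : 0 < a) {h : ℝ → ℝ} (hc : Continuous h)
    (t b c : ℝ) : IntervalIntegrable (fun s => (t - s) ^ (a - 1) * h s) volume b c :=
  (intervalIntegrable_rlKernel ha t b c).mul_continuousOn hc.continuousOn

theorem integral_rlKernel {a : ℝ} (ha : 0 < a) (t b : ℝ) :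
    ∫ s in b..t, (t - s) ^ (a - 1) = (t - b) ^ a / a := by
  have := intervalIntegral.integral_comp_sub_left (a := b) (b := t)
    (fun x : ℝ => x ^ (a - 1)) t
  rw [this, integral_rpow (Or.inl (by linarith)), sub_self, sub_add_cancel, Real.zero_rpow ha.ne',
    sub_zero]

theorem rlIntegral_congr {a t : ℝ} (ht : 0 ≤ t) {x y : ℝ → ℝ}
    (h : ∀ s ∈ Icc 0 t, x s = y s) : rlIntegral a x t = rlIntegral a y t := by
  unfold rlIntegral
  split_ifs
  · exact h t ⟨ht, le_rfl⟩
  · congr 1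
    refine intervalIntegral.integral_congr fun s hs => ?_
    rw [uIcc_of_le ht] at hs
    simp only [h s hs]

theorem rlIntegral_zero_right {a : ℝ} (ha : 0 < a) (h : ℝ → ℝ) : rlIntegral a h 0 = 0 := by
  simp [rlIntegral_of_pos ha]

theorem rlIntegral_one (h : ℝ → ℝ) (t : ℝ) : rlIntegral 1 h t = ∫ s in (0 : ℝ)..t, h s := by
  simp [rlIntegral_of_pos one_pos]

theorem rlIntegral_add {a : ℝ} (ha : 0 < a) {h k : ℝ → ℝ} (hh : Continuous h) (hk : Continuous k)
    (t : ℝ) : rlIntegral a (fun s => h s + k s) t = rlIntegral a h t + rlIntegral a k t := by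
  simp only [rlIntegral_of_pos ha, mul_add]
  rw [intervalIntegral.integral_add (intervalIntegrable_rlKernel_mul ha hh t 0 t)
    (intervalIntegrable_rlKernel_mul ha hk t 0 t), mul_add]

theorem rlIntegral_const_mul {a : ℝ} (ha : 0 < a) (c : ℝ) (h : ℝ → ℝ) (t : ℝ) :
    rlIntegral a (fun s => c * h s) t = c * rlIntegral a h t := by
  simp only [rlIntegral_of_pos ha, mul_left_comm _ c]
  rw [intervalIntegral.integral_const_mul]
  ring

theorem rlIntegral_sub {a : ℝ} (ha : 0 < a) {h k : ℝ → ℝ} (hh : Continuous h) (hk : Continuous k)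
    (t : ℝ) : rlIntegral a (h - k) t = rlIntegral a h t - rlIntegral a k t := by
  simp only [rlIntegral_of_pos ha, Pi.sub_apply, mul_sub]
  rw [intervalIntegral.integral_sub (intervalIntegrable_rlKernel_mul ha hh t 0 t)
    (intervalIntegrable_rlKernel_mul ha hk t 0 t), mul_sub]

theorem rlIntegral_mono {a t : ℝ} (ha : 0 < a) (ht : 0 ≤ t) {h k : ℝ → ℝ} (hh : Continuous h)
    (hk : Continuous k) (hle : ∀ s ∈ Icc 0 t, h s ≤ k s) :
    rlIntegral a h t ≤ rlIntegral a k t := by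
  simp only [rlIntegral_of_pos ha]
  refine mul_le_mul_of_nonneg_left ?_ (by have := Real.Gamma_pos_of_pos ha; positivity)
  refine intervalIntegral.integral_mono_on ht (intervalIntegrable_rlKernel_mul ha hh t 0 t)
    (intervalIntegrable_rlKernel_mul ha hk t 0 t) fun s hs => ?_
  exact mul_le_mul_of_nonneg_left (hle s hs) (Real.rpow_nonneg (by linarith [hs.2]) _)

/-- Reversing time factors out `exp (l * t)` and leaves a truncated Gamma integral. The gain `l ^
(-a)` makes the solution operator contract in a weighted norm for large `l`. -/
theorem rlIntegral_exp_le {a l t : ℝ} (ha : 0 < a) (hl : 0 < l) (ht : 0 ≤ t) :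
    rlIntegral a (fun s => Real.exp (l * s)) t ≤ Real.exp (l * t) / l ^ a := by
  have hG := Real.Gamma_pos_of_pos ha
  have h1 : ∫ s in (0 : ℝ)..t, (t - s) ^ (a - 1) * Real.exp (l * s)
      = Real.exp (l * t) * ∫ s in (0 : ℝ)..t, s ^ (a - 1) * Real.exp (-(l * s)) := by
    have := intervalIntegral.integral_comp_sub_left (a := 0) (b := t)
      (fun x : ℝ => x ^ (a - 1) * Real.exp (l * (t - x))) t
    simp only [sub_sub_cancel, sub_self, sub_zero] at this
    rw [this, ← intervalIntegral.integral_const_mul]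
    refine intervalIntegral.integral_congr fun s _ => ?_
    have hexp : Real.exp (l * (t - s)) = Real.exp (l * t) * Real.exp (-(l * s)) := by
      rw [← Real.exp_add]
      ring_nf
    rw [hexp]
    ring
  have h2 : ∫ s in (0 : ℝ)..t, s ^ (a - 1) * Real.exp (-(l * s))
      ≤ (1 / l) ^ a * Real.Gamma a := by
    rw [← Real.integral_rpow_mul_exp_neg_mul_Ioi ha hl, intervalIntegral.integral_of_le ht]
    refine setIntegral_mono_set ?_ ?_ Ioc_subset_Ioi_self.eventuallyLE
    -- Integrability on the half-line is read off from the value: a non-integrable function would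
    -- have integral `0`, but this one is positive.
    · by_contra hni
      have := Real.integral_rpow_mul_exp_neg_mul_Ioi ha hl
      rw [integral_undef hni] at this
      have : 0 < (1 / l) ^ a * Real.Gamma a := by positivity
      linarith
    · refine (ae_restrict_iff' measurableSet_Ioi).2 (Eventually.of_forall fun s hs => ?_)
      exact mul_nonneg (Real.rpow_nonneg (le_of_lt hs) _) (Real.exp_nonneg _)
  rw [rlIntegral_of_pos ha, h1]
  calc _ ≤ 1 / Real.Gamma a * (Real.exp (l * t) * ((1 / l) ^ a * Real.Gamma a)) := by gcongr
    _ = _ := by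
      rw [Real.div_rpow zero_le_one hl.le, Real.one_rpow]
      field_simp

theorem abs_rlIntegral_le {a l t C : ℝ} (ha : 0 < a) (hl : 0 < l) (ht : 0 ≤ t) (hC : 0 ≤ C)
    {h : ℝ → ℝ} (hh : Continuous h) (hle : ∀ s ∈ Icc 0 t, |h s| ≤ C * Real.exp (l * s)) :
    |rlIntegral a h t| ≤ C * Real.exp (l * t) / l ^ a := by
  have hce : Continuous fun s => C * Real.exp (l * s) := by fun_prop
  have hE : rlIntegral a (fun s => C * Real.exp (l * s)) t ≤ C * Real.exp (l * t) / l ^ a := by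
    rw [rlIntegral_const_mul ha, mul_div_assoc]
    exact mul_le_mul_of_nonneg_left (rlIntegral_exp_le ha hl ht) hC
  have h1 := rlIntegral_mono ha ht hh hce fun s hs => (abs_le.1 (hle s hs)).2
  have h2 := rlIntegral_mono ha ht (h := fun s => -1 * (C * Real.exp (l * s))) (by fun_prop) hh
    fun s hs => by linarith [(abs_le.1 (hle s hs)).1]
  rw [rlIntegral_const_mul ha] at h2
  exact abs_le.2 ⟨by linarith, by linarith⟩

/-- Rescaling to `[0, 1]` fixes both the interval and the singularity, so that continuity in `t`
becomes a matter of dominated convergence. -/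
theorem rlIntegral_eq_scaled {a t : ℝ} (ha : 0 < a) (ht : 0 ≤ t) (h : ℝ → ℝ) :
    rlIntegral a h t =
      t ^ a / Real.Gamma a * ∫ s in (0 : ℝ)..1, (1 - s) ^ (a - 1) * h (t * s) := by
  rcases ht.eq_or_lt with rfl | ht
  · simp [rlIntegral_zero_right ha, Real.zero_rpow ha.ne']
  have := intervalIntegral.integral_comp_mul_left (a := 0) (b := 1)
    (fun x : ℝ => (t - x) ^ (a - 1) * h x) ht.ne'
  rw [mul_zero, mul_one] at this
  have h2 : ∫ s in (0 : ℝ)..1, (t - t * s) ^ (a - 1) * h (t * s)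
      = t ^ (a - 1) * ∫ s in (0 : ℝ)..1, (1 - s) ^ (a - 1) * h (t * s) := by
    rw [← intervalIntegral.integral_const_mul]
    refine intervalIntegral.integral_congr fun s hs => ?_
    rw [uIcc_of_le zero_le_one] at hs
    rw [← mul_one_sub, Real.mul_rpow ht.le (by linarith [hs.2]), mul_assoc]
  rw [h2, smul_eq_mul] at this
  rw [rlIntegral_of_pos ha, ← mul_inv_cancel_left₀ ht.ne' (∫ s in (0 : ℝ)..t, _), ← this,
    Real.rpow_sub_one ht.ne']
  field_simp

theorem continuousOn_rlIntegral {a : ℝ} (ha : 0 < a) {h : ℝ → ℝ} (hc : Continuous h) {B : ℝ}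
    (hB : ∀ s, |h s| ≤ B) : ContinuousOn (rlIntegral a h) (Ici 0) := by
  have hcont : Continuous fun t : ℝ => ∫ s in (0 : ℝ)..1, (1 - s) ^ (a - 1) * h (t * s) := by
    refine intervalIntegral.continuous_of_dominated_interval
      (bound := fun s => (1 - s) ^ (a - 1) * B) (fun t => ?_) (fun t => ?_) ?_ ?_
    · have : Continuous fun s => h (t * s) := by fun_prop
      exact (intervalIntegrable_rlKernel_mul ha this 1 0 1).def'.aestronglyMeasurable
    · refine Eventually.of_forall fun s hs => ?_
      rw [uIoc_of_le zero_le_one] at hs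
      have : 0 ≤ (1 - s) ^ (a - 1) := Real.rpow_nonneg (by linarith [hs.2]) _
      rw [Real.norm_eq_abs, abs_mul, abs_of_nonneg this]
      exact mul_le_mul_of_nonneg_left (hB _) this
    · exact (intervalIntegrable_rlKernel ha 1 0 1).mul_const B
    · exact Eventually.of_forall fun s _ => by fun_prop
  have h2 : ContinuousOn (fun t : ℝ => t ^ a / Real.Gamma a *
      ∫ s in (0 : ℝ)..1, (1 - s) ^ (a - 1) * h (t * s)) (Ici 0) :=
    (((Real.continuous_rpow_const ha.le).div_const _).mul hcont).continuousOn
  exact h2.congr fun t ht => rlIntegral_eq_scaled ha ht h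

/-! ### Memory estimates and the positivity principle for scalar equations. -/

/-- Contribution of the history on `[0, s]` to the fractional integral at a later time `t`. -/
noncomputable def rlHistory (a : ℝ) (h : ℝ → ℝ) (s t : ℝ) : ℝ :=
  (1 / Real.Gamma a) * ∫ u in (0 : ℝ)..s, (t - u) ^ (a - 1) * h u

theorem rlIntegral_sub_rlHistory {a : ℝ} (ha : 0 < a) {h : ℝ → ℝ} (hc : Continuous h) (s t : ℝ) :
    rlIntegral a h t - rlHistory a h s t =
      (1 / Real.Gamma a) * ∫ u in s..t, (t - u) ^ (a - 1) * h u := by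
  rw [rlIntegral_of_pos ha, rlHistory, ← mul_sub, intervalIntegral.integral_interval_sub_left
    (intervalIntegrable_rlKernel_mul ha hc t 0 t) (intervalIntegrable_rlKernel_mul ha hc t 0 s)]

/-- The recent piece `[s, t]` contributes at most the bound `B` times the mass of the kernel there.
This controls pairs `s ≤ t` that are close together. -/
theorem rlHistory_ge {a B s t : ℝ} (ha : 0 < a) {h : ℝ → ℝ} (hc : Continuous h)
    (hB : ∀ s, |h s| ≤ B) (hst : s ≤ t) :
    rlIntegral a h t - B / Real.Gamma a * ((t - s) ^ a / a) ≤ rlHistory a h s t := by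
  have h1 := rlIntegral_sub_rlHistory ha hc s t
  have h2 : ∫ u in s..t, (t - u) ^ (a - 1) * h u ≤ ((t - s) ^ a / a) * B := by
    rw [← integral_rlKernel ha, ← intervalIntegral.integral_mul_const]
    refine intervalIntegral.integral_mono_on hst (intervalIntegrable_rlKernel_mul ha hc t s t)
      ((intervalIntegrable_rlKernel ha t s t).mul_const B) fun u hu => ?_
    exact mul_le_mul_of_nonneg_left (abs_le.1 (hB u)).2 (Real.rpow_nonneg (by linarith [hu.2]) _)
  have h3 := mul_le_mul_of_nonneg_left h2 (one_div_nonneg.2 (Real.Gamma_pos_of_pos ha).le)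
  have h4 : 1 / Real.Gamma a * (((t - s) ^ a / a) * B) = B / Real.Gamma a * ((t - s) ^ a / a) := by
    ring
  linarith

theorem hasDerivAt_rlHistory {a s t : ℝ} (ha : 0 < a) {h : ℝ → ℝ} (hc : Continuous h)
    (hst : s < t) :
    HasDerivAt (fun s => rlHistory a h s t) (1 / Real.Gamma a * ((t - s) ^ (a - 1) * h s)) s := by
  refine HasDerivAt.const_mul _ ?_
  have hcont : ContinuousAt (fun u => (t - u) ^ (a - 1) * h u) s := by
    refine ContinuousAt.mul ?_ hc.continuousAt
    exact (continuousAt_const.sub continuousAt_id).rpow_const (Or.inl (sub_ne_zero.2 hst.ne'))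
  refine intervalIntegral.integral_hasDerivAt_right
    (intervalIntegrable_rlKernel_mul ha hc t 0 s) ?_ hcont
  refine ContinuousOn.stronglyMeasurableAtFilter (s := Iio t) isOpen_Iio ?_ s hst
  intro u hu
  refine ContinuousWithinAt.mul ?_ hc.continuousWithinAt
  exact ((continuousAt_const.sub continuousAt_id).rpow_const
    (Or.inl (sub_ne_zero.2 (ne_of_gt hu)))).continuousWithinAt

theorem continuousOn_rlHistory {a : ℝ} (ha : 0 < a) {h : ℝ → ℝ} (hc : Continuous h)
    {s : ℝ} (hs : 0 ≤ s) (t : ℝ) : ContinuousOn (fun s => rlHistory a h s t) (Icc 0 s) := by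
  have := intervalIntegral.continuousOn_primitive_interval' (a := 0)
    (intervalIntegrable_rlKernel_mul ha hc t 0 s) left_mem_uIcc
  rw [uIcc_of_le hs] at this
  exact continuousOn_const.mul this

/-- Comparison of the history seen from two times, by log-convexity of the kernel. -/
theorem rlHistory_ge_convex {a s t z m : ℝ} (ha : 0 < a) (ha1 : a < 1) {h : ℝ → ℝ}
    (hc : Continuous h) (hs : 0 ≤ s) (hst : s < t)
    (hm : ∀ u ∈ Icc 0 s, m ≤ z + rlHistory a h u s) :
    (1 - (s / t) ^ (1 - a)) * z + (s / t) ^ (1 - a) * m ≤ z + rlHistory a h s t := by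
  have ha1' : 0 < 1 - a := sub_pos.2 ha1
  -- `θ` is the ratio of the kernel seen from `t` to the one seen from `s`; it decreases to `0` at
  -- `u = s`. In the derivative of `H` the two kernel terms cancel, leaving `-θ'` times a
  -- nonnegative factor, and the claim is `H 0 ≤ H s`.
  set θ : ℝ → ℝ := fun u => ((s - u) / (t - u)) ^ (1 - a) with hθ
  set H : ℝ → ℝ := fun u => z + rlHistory a h u t - θ u * (z + rlHistory a h u s - m) with hH
  have hθc : ContinuousOn θ (Icc 0 s) := by
    refine ContinuousOn.rpow_const ?_ fun _ _ => Or.inr ha1'.le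
    refine ContinuousOn.div (by fun_prop) (by fun_prop) fun u hu => ?_
    linarith [hu.2]
  have hHc : ContinuousOn H (Icc 0 s) :=
    (continuousOn_const.add (continuousOn_rlHistory ha hc hs t)).sub
      (hθc.mul ((continuousOn_const.add (continuousOn_rlHistory ha hc hs s)).sub
        continuousOn_const))
  have hderiv : ∀ u ∈ Ioo 0 s, ∃ c, 0 ≤ c ∧ HasDerivAt H c u := by
    intro u hu
    have hsu : 0 < s - u := sub_pos.2 hu.2
    have htu : 0 < t - u := by linarith
    have hb : HasDerivAt (fun u => (s - u) / (t - u)) ((-1 * (t - u) - (s - u) * -1) / (t - u) ^ 2)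
        u := ((hasDerivAt_id u).const_sub s).div ((hasDerivAt_id u).const_sub t) htu.ne'
    have hq : 0 < (s - u) / (t - u) := div_pos hsu htu
    have hθ' := hb.rpow_const (p := 1 - a) (Or.inl hq.ne')
    have hd := ((hasDerivAt_rlHistory ha hc (hu.2.trans hst)).const_add z).sub
      (hθ'.mul (((hasDerivAt_rlHistory ha hc hu.2).const_add z).sub_const m))
    refine ⟨_, ?_, hd⟩
    have hk : ((s - u) / (t - u)) ^ (1 - a) * (s - u) ^ (a - 1) = (t - u) ^ (a - 1) := by
      rw [Real.div_rpow hsu.le htu.le, div_mul_eq_mul_div, ← Real.rpow_add hsu,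
        show 1 - a + (a - 1) = 0 by ring, Real.rpow_zero, one_div, ← Real.rpow_neg htu.le, neg_sub]
    have hneg : (-1 * (t - u) - (s - u) * -1) / (t - u) ^ 2 * (1 - a) *
        ((s - u) / (t - u)) ^ (1 - a - 1) ≤ 0 := by
      refine mul_nonpos_of_nonpos_of_nonneg (mul_nonpos_of_nonpos_of_nonneg ?_ ha1'.le)
        (Real.rpow_nonneg hq.le _)
      exact div_nonpos_of_nonpos_of_nonneg (by linarith) (sq_nonneg _)
    have hmu := sub_nonneg.2 (hm u ⟨hu.1.le, hu.2.le⟩)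
    have := mul_nonpos_of_nonpos_of_nonneg hneg hmu
    rw [← hk]
    nlinarith
  have hmono : MonotoneOn H (Icc 0 s) := by
    refine monotoneOn_of_deriv_nonneg (convex_Icc 0 s) hHc ?_ ?_
    · intro u hu
      rw [interior_Icc] at hu
      obtain ⟨c, -, hc⟩ := hderiv u hu
      exact hc.differentiableAt.differentiableWithinAt
    · intro u hu
      rw [interior_Icc] at hu
      obtain ⟨c, hc0, hc⟩ := hderiv u hu
      rwa [hc.deriv]
  have := hmono (left_mem_Icc.2 hs) (right_mem_Icc.2 hs) hs
  simp only [hH, hθ, sub_zero, sub_self, zero_div, Real.zero_rpow ha1'.ne', zero_mul] at this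
  have h0 : ∀ t, rlHistory a h 0 t = 0 := fun t => by simp [rlHistory]
  rw [h0, h0] at this
  linarith

/-- Let `m` be the infimum over all pairs `s ≤ t ≤ T` and suppose `m < 0`. Close pairs have value at
least `m / 2` by `rlHistory_ge`; for separated pairs `rlHistory_ge_convex` gives at least `q * m`
with a uniform `q < 1`. Hence `m ≥ q * m`, which is absurd. -/
theorem rlHistory_nonneg {a z T B : ℝ} (ha : 0 < a) (ha1 : a ≤ 1) {h : ℝ → ℝ}
    (hc : Continuous h) (hB : ∀ s, |h s| ≤ B) (hz : 0 ≤ z)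
    (hpos : ∀ t ∈ Icc 0 T, 0 ≤ z + rlIntegral a h t) {s t : ℝ} (hs : 0 ≤ s) (hst : s ≤ t)
    (htT : t ≤ T) : 0 ≤ z + rlHistory a h s t := by
  rcases ha1.eq_or_lt with rfl | ha1
  · have := hpos s ⟨hs, hst.trans htT⟩
    rw [rlIntegral_one] at this
    simpa [rlHistory] using this
  have hB0 : 0 ≤ B := (abs_nonneg _).trans (hB 0)
  have hG := Real.Gamma_pos_of_pos ha
  set S : Set ℝ := {y | ∃ s t, 0 ≤ s ∧ s ≤ t ∧ t ≤ T ∧ y = z + rlHistory a h s t} with hS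
  have hbound : ∀ s t, 0 ≤ s → s ≤ t → t ≤ T →
      -(B / Real.Gamma a * ((t - s) ^ a / a)) ≤ z + rlHistory a h s t := fun s t hs hst ht => by
    linarith [rlHistory_ge ha hc hB hst, hpos t ⟨hs.trans hst, ht⟩]
  have hbdd : BddBelow S := by
    refine ⟨-(B / Real.Gamma a * (T ^ a / a)), ?_⟩
    rintro _ ⟨s, t, hs, hst, ht, rfl⟩
    refine le_trans ?_ (hbound s t hs hst ht)
    have : (t - s) ^ a ≤ T ^ a := Real.rpow_le_rpow (by linarith) (by linarith) ha.le
    gcongr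
  have hne : S.Nonempty := ⟨_, s, t, hs, hst, htT, rfl⟩
  suffices h0 : 0 ≤ sInf S from h0.trans (csInf_le hbdd ⟨s, t, hs, hst, htT, rfl⟩)
  by_contra hneg
  rw [not_le] at hneg
  set m := sInf S with hm
  obtain ⟨δ, hδ, hδm⟩ : ∃ δ > 0, B / Real.Gamma a * (δ ^ a / a) ≤ -m / 2 := by
    have hlim : Tendsto (fun δ : ℝ => B / Real.Gamma a * (δ ^ a / a)) (𝓝[>] 0) (𝓝 0) := by
      have hct : Continuous (fun δ : ℝ => B / Real.Gamma a * (δ ^ a / a)) :=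
        continuous_const.mul ((Real.continuous_rpow_const ha.le).div_const _)
      have := hct.tendsto 0
      rw [Real.zero_rpow ha.ne', zero_div, mul_zero] at this
      exact this.mono_left nhdsWithin_le_nhds
    obtain ⟨δ, h1, h2⟩ := ((hlim.eventually (ge_mem_nhds (show (0:ℝ) < -m / 2 by linarith))).and
      self_mem_nhdsWithin).exists
    exact ⟨δ, h2, h1⟩
  have hT : 0 ≤ T := hs.trans (hst.trans htT)
  -- Separation by `δ` inside `[0, T]` forces `s / t ≤ 1 - δ / T`. Requiring `1 / 2 ≤ q` makes `q *
  -- m ≤ m / 2`, so one bound serves close pairs too.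
  obtain ⟨q, hq1, hqm, hq⟩ : ∃ q < 1, 1 / 2 ≤ q ∧ ∀ s t, 0 ≤ s → s + δ < t → t ≤ T →
      (s / t) ^ (1 - a) ≤ q := by
    rcases lt_or_ge T δ with hTδ | hTδ
    · exact ⟨1 / 2, by norm_num, le_rfl, fun s t hs h1 h2 => by linarith⟩
    · have hTp : 0 < T := hδ.trans_le hTδ
      have hb : 0 ≤ 1 - δ / T := sub_nonneg.2 ((div_le_one hTp).2 hTδ)
      refine ⟨max (1 / 2) ((1 - δ / T) ^ (1 - a)), max_lt (by norm_num) ?_, le_max_left _ _,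
        fun s t hs h1 h2 => le_trans ?_ (le_max_right _ _)⟩
      · exact Real.rpow_lt_one hb (sub_lt_self _ (by positivity)) (by linarith)
      · have htp : 0 < t := by linarith
        refine Real.rpow_le_rpow (by positivity) ?_ (by linarith)
        rw [div_le_iff₀ htp, sub_mul, one_mul]
        have : δ / T * t ≤ δ := by
          rw [div_mul_eq_mul_div, div_le_iff₀ hTp]
          exact mul_le_mul_of_nonneg_left h2 hδ.le
        linarith
  have hge : q * m ≤ m := by
    refine le_csInf hne ?_
    rintro _ ⟨s, t, hs, hst, ht, rfl⟩
    rcases le_or_gt t (s + δ) with hd | hd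
    · refine le_trans ?_ (hbound s t hs hst ht)
      have : (t - s) ^ a ≤ δ ^ a := Real.rpow_le_rpow (by linarith) (by linarith) ha.le
      have : B / Real.Gamma a * ((t - s) ^ a / a) ≤ B / Real.Gamma a * (δ ^ a / a) := by gcongr
      nlinarith
    · have h1 := rlHistory_ge_convex (z := z) (m := m) ha ha1 hc hs (by linarith : s < t)
        fun u hu => csInf_le hbdd ⟨u, s, hu.1, hu.2, by linarith, rfl⟩
      have h2 := hq s t hs hd ht
      have h3 : 0 ≤ (1 - (s / t) ^ (1 - a)) * z := mul_nonneg (by linarith) hz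
      nlinarith
  nlinarith

/-- Positivity for scalar fractional differential equations in Volterra form: a function starting
at a nonnegative value whose Caputo derivative is nonnegative wherever the function is nonpositive
stays nonnegative. -/
theorem rlIntegral_solution_nonneg {a w₀ B : ℝ} (ha : 0 < a) (ha1 : a ≤ 1) {h : ℝ → ℝ}
    (hc : Continuous h) (hB : ∀ s, |h s| ≤ B) (hw₀ : 0 ≤ w₀)
    (hpos : ∀ t, 0 ≤ t → w₀ + rlIntegral a h t ≤ 0 → 0 ≤ h t) {t : ℝ} (ht : 0 ≤ t) :
    0 ≤ w₀ + rlIntegral a h t := by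
  have hG := Real.Gamma_pos_of_pos ha
  have hone : ∀ t, 0 ≤ t → 0 ≤ rlIntegral a (fun _ => 1) t := fun t ht => by
    have := rlIntegral_mono (h := fun _ => 0 * (1 : ℝ)) (k := fun _ => 1) ha ht continuous_const
      continuous_const fun _ _ => by simp
    rwa [rlIntegral_const_mul ha, zero_mul] at this
  -- Perturbing both the initial value and the forcing by `ε` makes the start and the field strictly
  -- positive where needed.
  suffices key : ∀ ε > 0, ∀ t, 0 ≤ t → 0 < (w₀ + ε) + rlIntegral a (fun s => h s + ε) t by
    have hsplit : ∀ ε, rlIntegral a (fun s => h s + ε) t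
        = rlIntegral a h t + ε * rlIntegral a (fun _ => 1) t := fun ε => by
      rw [rlIntegral_add ha hc continuous_const, ← rlIntegral_const_mul ha]
      simp
    by_contra hneg
    rw [not_le] at hneg
    have h1 := hone t ht
    set y := w₀ + rlIntegral a h t
    set c := rlIntegral a (fun _ => 1) t
    -- For this `ε` the perturbed value `y + ε * (1 + c)` is exactly `0`.
    have := key (-y / (1 + c)) (div_pos (by linarith) (by linarith)) t ht
    rw [hsplit] at this
    have h2 : -y / (1 + c) * (1 + c) = -y := div_mul_cancel₀ _ (by linarith)
    nlinarith
  intro ε hε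
  set k : ℝ → ℝ := fun s => h s + ε with hk
  have hkc : Continuous k := by fun_prop
  have hkB : ∀ s, |k s| ≤ B + ε := fun s => (abs_add_le _ _).trans
    (add_le_add (hB s) (abs_of_pos hε).le)
  set Z : ℝ → ℝ := fun t => (w₀ + ε) + rlIntegral a k t with hZ
  have hZc : ContinuousOn Z (Ici 0) := continuousOn_const.add (continuousOn_rlIntegral ha hkc hkB)
  by_contra! hcon
  set S : Set ℝ := Ici 0 ∩ Z ⁻¹' Iic 0 with hS
  have hScl : IsClosed S := hZc.preimage_isClosed_of_isClosed isClosed_Ici isClosed_Iic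
  have hSne : S.Nonempty := let ⟨t, h1, h2⟩ := hcon; ⟨t, h1, h2⟩
  have hSb : BddBelow S := ⟨0, fun _ h => h.1⟩
  have ht₁ := hScl.csInf_mem hSne hSb
  set t₁ := sInf S with ht₁'
  have hlt : ∀ s, 0 ≤ s → s < t₁ → 0 < Z s := fun s hs hst => by
    by_contra hle
    exact absurd (csInf_le hSb (⟨hs, not_lt.1 hle⟩ : s ∈ S)) (not_le.2 hst)
  have hZ0 : Z 0 = w₀ + ε := by simp [hZ, rlIntegral_zero_right ha]
  have ht₁0 : 0 < t₁ := by
    refine lt_of_le_of_ne ht₁.1 fun h0 => ?_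
    have : Z t₁ ≤ 0 := ht₁.2
    rw [← h0, hZ0] at this
    linarith
  have hZt₁ : 0 ≤ Z t₁ := by
    have hcw : ContinuousWithinAt Z (Ico 0 t₁) t₁ :=
      (hZc t₁ ht₁0.le).mono fun x hx => hx.1
    have : t₁ ∈ closure (Ico 0 t₁) := by
      rw [closure_Ico ht₁0.ne]; exact right_mem_Icc.2 ht₁0.le
    exact isClosed_Ici.closure_subset (hcw.mem_closure this fun s hs => (hlt s hs.1 hs.2).le)
  have hnn : ∀ t ∈ Icc 0 t₁, 0 ≤ (w₀ + ε) + rlIntegral a k t := fun t ht => by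
    rcases ht.2.eq_or_lt with rfl | h'
    · exact hZt₁
    · exact (hlt t ht.1 h').le
  have hkpos : 0 < k t₁ := by
    have hle : w₀ + rlIntegral a h t₁ ≤ rlIntegral a k t₁ + (w₀ + ε) := by
      have := rlIntegral_mono ha ht₁0.le hc hkc fun s _ => by simp only [hk]; linarith
      linarith
    have : Z t₁ ≤ 0 := ht₁.2
    have := hpos t₁ ht₁0.le (by simp only [hZ] at this; linarith)
    simp only [hk]
    linarith
  obtain ⟨t₀, ht₀, hkt₀⟩ : ∃ t₀ ∈ Ico 0 t₁, ∀ u ∈ Ioc t₀ t₁, 0 < k u := by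
    have : ∀ᶠ u in 𝓝[≤] t₁, 0 < k u :=
      (hkc.continuousAt.eventually (lt_mem_nhds hkpos)).filter_mono nhdsWithin_le_nhds
    obtain ⟨l, hl, hls⟩ := (mem_nhdsLE_iff_exists_mem_Ico_Ioc_subset ht₁0).1 this
    exact ⟨l, hl, hls⟩
  -- At the first zero `t₁`, the initial value plus the memory up to `t₀` is nonnegative and the
  -- forcing on `(t₀, t₁]` adds a strictly positive amount, so `Z t₁ > 0`.
  have h1 := rlHistory_nonneg ha ha1 hkc hkB (by linarith : 0 ≤ w₀ + ε) hnn ht₀.1 ht₀.2.le le_rfl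
  have h2 := rlIntegral_sub_rlHistory ha hkc t₀ t₁
  have h3 : 0 < ∫ u in t₀..t₁, (t₁ - u) ^ (a - 1) * k u := by
    refine intervalIntegral.intervalIntegral_pos_of_pos_on
      (intervalIntegrable_rlKernel_mul ha hkc _ _ _) (fun u hu => ?_) ht₀.2
    exact mul_pos (Real.rpow_pos_of_pos (by linarith [hu.2]) _) (hkt₀ u ⟨hu.1, hu.2.le⟩)
  have h4 : 0 < 1 / Real.Gamma a * ∫ u in t₀..t₁, (t₁ - u) ^ (a - 1) * k u := by positivity
  have h5 : Z t₁ ≤ 0 := ht₁.2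
  simp only [hZ] at h5
  linarith

/-! ### Composition of fractional integrals and the equivalence of Caputo and Volterra forms. -/

theorem integral_beta_of_add_eq_one {a b : ℝ} (ha : 0 < a) (hb : 0 < b) (hab : a + b = 1) {t : ℝ}
    (ht : 0 < t) : ∫ s in (0 : ℝ)..t, s ^ (a - 1) * (t - s) ^ (b - 1) =
      Real.Gamma a * Real.Gamma b := by
  have h1 := Complex.betaIntegral_scaled (a : ℂ) (b : ℂ) ht
  rw [show (a : ℂ) + b - 1 = 0 by rw [← Complex.ofReal_add, hab]; simp, Complex.cpow_zero, one_mul,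
    Complex.betaIntegral_eq_Gamma_mul_div _ _ (by simpa) (by simpa), ← Complex.ofReal_add, hab,
    Complex.ofReal_one, Complex.Gamma_one, div_one, Complex.Gamma_ofReal, Complex.Gamma_ofReal,
    ← Complex.ofReal_mul] at h1
  rw [← Complex.ofReal_inj, ← h1, ← intervalIntegral.integral_ofReal]
  refine intervalIntegral.integral_congr fun s hs => ?_
  rw [uIcc_of_le ht.le] at hs
  simp only [Complex.ofReal_mul]
  rw [Complex.ofReal_cpow hs.1, Complex.ofReal_cpow (sub_nonneg.2 hs.2)]
  simp

open scoped Convolution in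
/-- The convolution of two functions supported in `(0, T]`. -/
theorem convolution_indicator_Ioc {T t : ℝ} (ht : t ∈ Icc 0 T) (f g : ℝ → ℝ) :
    (((Ioc 0 T).indicator f) ⋆[ContinuousLinearMap.mul ℝ ℝ] ((Ioc 0 T).indicator g)) t =
      ∫ s in (0 : ℝ)..t, f s * g (t - s) := by
  have h : ∀ s, (Ioc 0 T).indicator f s * (Ioc 0 T).indicator g (t - s)
      = (Ioo 0 t).indicator (fun s => f s * g (t - s)) s := fun s => by
    by_cases hs : s ∈ Ioo 0 t
    · rw [indicator_of_mem hs, indicator_of_mem, indicator_of_mem]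
      · exact ⟨by linarith [hs.2], by linarith [hs.1, ht.2]⟩
      · exact ⟨hs.1, by linarith [hs.2, ht.2]⟩
    · rw [indicator_of_notMem hs]
      by_cases h1 : s ∈ Ioc 0 T
      · have : t - s ∉ Ioc 0 T := fun h2 => hs ⟨h1.1, by linarith [h2.1]⟩
        rw [indicator_of_notMem this, mul_zero]
      · rw [indicator_of_notMem h1, zero_mul]
  simp only [convolution_def, ContinuousLinearMap.mul_apply', h]
  rw [integral_indicator measurableSet_Ioo, ← integral_Ioc_eq_integral_Ioo,
    intervalIntegral.integral_of_le ht.1]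

open scoped Convolution in
-- Convolution of truncated kernels is associative, and by the Beta integral the two kernels
-- convolve to the constant `Γ(a) Γ(b)` on `(0, t]`.
theorem rlIntegral_rlIntegral {a b : ℝ} (ha : 0 < a) (hb : 0 < b) (hab : a + b = 1) {x : ℝ → ℝ}
    (hc : Continuous x) {B : ℝ} (hB : ∀ s, |x s| ≤ B) {t : ℝ} (ht : 0 ≤ t) :
    rlIntegral a (rlIntegral b x) t = ∫ s in (0 : ℝ)..t, x s := by
  set L := ContinuousLinearMap.mul ℝ ℝ
  set F : ℝ → ℝ := (Ioc 0 t).indicator fun s => s ^ (a - 1) with hF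
  set G : ℝ → ℝ := (Ioc 0 t).indicator fun s => s ^ (b - 1) with hG
  set X : ℝ → ℝ := (Ioc 0 t).indicator x with hX
  have hker : ∀ {c : ℝ}, 0 < c → Integrable ((Ioc 0 t).indicator fun s : ℝ => s ^ (c - 1)) := by
    intro c hc
    rw [integrable_indicator_iff measurableSet_Ioc, ← intervalIntegrable_iff_integrableOn_Ioc_of_le ht]
    exact intervalIntegral.intervalIntegrable_rpow' (by linarith)
  have hFi : Integrable F := hker ha
  have hGi : Integrable G := hker hb
  have hXi : Integrable X := by
    rw [hX, integrable_indicator_iff measurableSet_Ioc,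
      ← intervalIntegrable_iff_integrableOn_Ioc_of_le ht]
    exact hc.intervalIntegrable 0 t
  have hB0 : 0 ≤ B := (abs_nonneg _).trans (hB 0)
  have hXB : ∀ s, |X s| ≤ B := fun s => by
    rw [hX, indicator_apply]
    split_ifs
    · exact hB s
    · simpa using hB0
  have hGX : ∀ y, ConvolutionExistsAt (fun s => ‖G s‖) (fun s => ‖X s‖) y L := fun y => by
    refine BddAbove.convolutionExistsAt L (s := univ) ?_ MeasurableSet.univ (subset_univ _)
      hGi.norm.integrableOn hXi.norm.aestronglyMeasurable
    refine ⟨B, ?_⟩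
    rintro _ ⟨s, -, rfl⟩
    simpa using hXB s
  have key := convolution_assoc (f := F) (g := G) (k := X) (x₀ := t) L L L L
    (fun x y z => mul_assoc x y z) hFi.aestronglyMeasurable hGi.aestronglyMeasurable
    hXi.aestronglyMeasurable (hFi.ae_convolution_exists L hGi) (Eventually.of_forall hGX) (by
      refine BddAbove.convolutionExistsAt L (s := univ) ?_ MeasurableSet.univ (subset_univ _)
        hFi.norm.integrableOn (hGi.norm.integrable_convolution L hXi.norm).aestronglyMeasurable
      refine ⟨(∫ s, ‖G s‖) * B, ?_⟩
      rintro _ ⟨s, -, rfl⟩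
      simp only [convolution_def]
      rw [← integral_mul_const]
      refine (norm_integral_le_integral_norm _).trans (integral_mono (hGX s).norm
        (hGi.norm.mul_const B) fun u => ?_)
      simp only [ContinuousLinearMap.mul_apply', norm_mul, norm_norm]
      exact mul_le_mul_of_nonneg_left (hXB _) (norm_nonneg _))
  have hflip : ∀ {c : ℝ} (y : ℝ → ℝ) (u : ℝ), ∫ s in (0 : ℝ)..u, (u - s) ^ (c - 1) * y s
      = ∫ s in (0 : ℝ)..u, s ^ (c - 1) * y (u - s) := fun {c} y u => by
    have := intervalIntegral.integral_comp_sub_left (a := 0) (b := u)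
      (fun s : ℝ => s ^ (c - 1) * y (u - s)) u
    simpa using this
  have hleft : ((F ⋆[L] G) ⋆[L] X) t
      = Real.Gamma a * Real.Gamma b * ∫ s in (0 : ℝ)..t, x s := by
    have h1 : ∀ s ∈ Ioc 0 t, (F ⋆[L] G) s = Real.Gamma a * Real.Gamma b := fun s hs => by
      rw [convolution_indicator_Ioc ⟨hs.1.le, hs.2⟩, integral_beta_of_add_eq_one ha hb hab hs.1]
    have h2 : ((F ⋆[L] G) ⋆[L] X) t
        = (((Ioc 0 t).indicator fun _ => Real.Gamma a * Real.Gamma b) ⋆[L] X) t := by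
      simp only [convolution_def, L, ContinuousLinearMap.mul_apply']
      refine integral_congr_ae ?_
      have h0 : ∀ᵐ s : ℝ, s ≠ 0 := by simp [ae_iff]
      have ht' : ∀ᵐ s : ℝ, s ≠ t := by simp [ae_iff]
      filter_upwards [h0, ht'] with s _ _
      by_cases hs : s ∈ Ioc 0 t
      · rw [indicator_of_mem hs]
        exact congrArg (· * X (t - s)) (h1 s hs)
      · have : X (t - s) = 0 ∨ (F ⋆[L] G) s = 0 := by
          by_cases hs0 : 0 < s
          · left
            refine indicator_of_notMem (fun h => hs ⟨hs0, by linarith [h.1]⟩) _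
          · right
            rw [convolution_def]
            refine integral_eq_zero_of_ae (Eventually.of_forall fun u => ?_)
            simp only [L, ContinuousLinearMap.mul_apply', Pi.zero_apply, hF, hG, indicator_apply]
            split_ifs with h1 h2
            · exact absurd h2.1 (by linarith [h1.1])
            all_goals simp
        rw [indicator_of_notMem hs, zero_mul]
        rcases this with h | h
        · rw [h, mul_zero]
        · exact (congrArg (· * X (t - s)) h).trans (zero_mul _)
    rw [h2, convolution_indicator_Ioc ⟨ht, le_rfl⟩, intervalIntegral.integral_const_mul]
    congr 1
    simp
  have hright : (F ⋆[L] (G ⋆[L] X)) t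
      = Real.Gamma a * Real.Gamma b * rlIntegral a (rlIntegral b x) t := by
    have h1 : ∀ s ∈ Icc 0 t, (G ⋆[L] X) s = Real.Gamma b * rlIntegral b x s := fun s hs => by
      rw [convolution_indicator_Ioc hs, rlIntegral_of_pos hb, hflip]
      have := Real.Gamma_pos_of_pos hb
      field_simp
    have h2 : (F ⋆[L] (G ⋆[L] X)) t
        = (F ⋆[L] ((Ioc 0 t).indicator fun s => Real.Gamma b * rlIntegral b x s)) t := by
      simp only [convolution_def, L, ContinuousLinearMap.mul_apply']
      refine integral_congr_ae ?_
      have ht' : ∀ᵐ s : ℝ, s ≠ t := by simp [ae_iff]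
      filter_upwards [ht'] with s hst
      by_cases hs : s ∈ Ioc 0 t
      · have : t - s ∈ Ioc 0 t :=
          ⟨sub_pos.2 (lt_of_le_of_ne hs.2 hst), by linarith [hs.1]⟩
        rw [indicator_of_mem this]
        exact congrArg (F s * ·) (h1 _ ⟨this.1.le, this.2⟩)
      · simp [hF, indicator_of_notMem hs]
    rw [h2, convolution_indicator_Ioc ⟨ht, le_rfl⟩, rlIntegral_of_pos ha, hflip,
      ← mul_assoc, ← intervalIntegral.integral_const_mul]
    refine intervalIntegral.integral_congr fun s _ => ?_
    have := Real.Gamma_pos_of_pos ha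
    field_simp
  have hGa := Real.Gamma_pos_of_pos ha
  have hGb := Real.Gamma_pos_of_pos hb
  exact mul_left_cancel₀ (mul_pos hGa hGb).ne' (hright.symm.trans (key.symm.trans hleft))

/-- A function continuous on `[a, b]` agrees there with a bounded continuous function. -/
theorem exists_bounded_continuous_extension {E : Type*} [NormedAddCommGroup E] {a b : ℝ}
    (hab : a ≤ b) {x : ℝ → E} (hx : ContinuousOn x (Icc a b)) :
    ∃ y : ℝ → E, Continuous y ∧ (∃ B, ∀ s, ‖y s‖ ≤ B) ∧ ∀ s ∈ Icc a b, y s = x s := by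
  refine ⟨fun s => x (max a (min s b)), ?_, ?_, ?_⟩
  · exact hx.comp_continuous (by fun_prop) fun s =>
      ⟨le_max_left _ _, max_le hab (min_le_right _ _)⟩
  · obtain ⟨B, hB⟩ := isCompact_Icc.exists_bound_of_continuousOn hx
    exact ⟨B, fun s => hB _ ⟨le_max_left _ _, max_le hab (min_le_right _ _)⟩⟩
  · intro s hs
    simp only [min_eq_left hs.2, max_eq_right hs.1]

/-- Here `I^(1-a) (x - x 0) = I^(1-a) I^a h = ∫ h`, and the fundamental theorem of calculus applies.
-/
theorem hasCaputoDerivAt_of_volterra {a x₀ B : ℝ} (ha : 0 < a) (ha1 : a ≤ 1) {h x : ℝ → ℝ}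
    (hc : Continuous h) (hB : ∀ s, |h s| ≤ B) (hx : ∀ t, 0 ≤ t → x t = x₀ + rlIntegral a h t)
    {t : ℝ} (ht : 0 < t) : HasCaputoDerivAt a x (h t) t := by
  have hx0 : x 0 = x₀ := by rw [hx 0 le_rfl, rlIntegral_zero_right ha, add_zero]
  have heq : ∀ s, 0 ≤ s → rlIntegral (1 - a) (fun s => x s - x 0) s = ∫ u in (0 : ℝ)..s, h u := by
    intro s hs
    have h1 : rlIntegral (1 - a) (fun s => x s - x 0) s = rlIntegral (1 - a) (rlIntegral a h) s :=
      rlIntegral_congr hs fun u hu => by rw [hx u hu.1, hx0]; ring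
    rw [h1]
    rcases ha1.eq_or_lt with rfl | ha1
    · simp [rlIntegral, sub_self]
    · exact rlIntegral_rlIntegral (sub_pos.2 ha1) ha (by ring) hc hB hs
  refine (intervalIntegral.integral_hasDerivAt_right (hc.intervalIntegrable 0 t)
    (hc.stronglyMeasurableAtFilter _ _) hc.continuousAt).congr_of_eventuallyEq ?_
  filter_upwards [lt_mem_nhds ht] with s hs using heq s hs.le

/-- With `y = x - x 0` and `k = I^a h`, integrating the derivative gives `I^(1-a) y = ∫ h = I^(1-a)
k`. Applying `I^a` yields `∫ y = ∫ k`, and differentiation gives `y = k`. For `a = 1` the operator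
`I^0` is the identity and the first equality suffices. -/
theorem volterra_of_hasCaputoDerivAt {a T B : ℝ} (ha : 0 < a) (ha1 : a ≤ 1) {h x : ℝ → ℝ}
    (hx : ContinuousOn x (Icc 0 T)) (hc : Continuous h) (hB : ∀ s, |h s| ≤ B)
    (hD : ∀ t ∈ Ioo 0 T, HasCaputoDerivAt a x (h t) t) {t : ℝ} (ht : t ∈ Icc 0 T) :
    x t = x 0 + rlIntegral a h t := by
  have hT : 0 ≤ T := ht.1.trans ht.2
  rcases hT.eq_or_lt with rfl | hT'
  · rw [le_antisymm ht.2 ht.1, rlIntegral_zero_right ha, add_zero]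
  obtain ⟨y, hyc, ⟨C, hyC⟩, hy⟩ := exists_bounded_continuous_extension hT
    (x := fun s => x s - x 0) (hx.sub continuousOn_const)
  obtain ⟨k, hkc, ⟨C', hkC⟩, hk⟩ := exists_bounded_continuous_extension hT
    ((continuousOn_rlIntegral ha hc hB).mono Icc_subset_Ici_self)
  have hJ : ∀ t ∈ Icc 0 T, rlIntegral (1 - a) (fun s => x s - x 0) t = rlIntegral (1 - a) y t :=
    fun t ht => rlIntegral_congr ht.1 fun s hs => (hy s ⟨hs.1, hs.2.trans ht.2⟩).symm
  have hJc : ContinuousOn (rlIntegral (1 - a) (fun s => x s - x 0)) (Icc 0 T) := by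
    rcases ha1.eq_or_lt with rfl | ha1
    · have : rlIntegral (1 - 1) (fun s => x s - x 0) = fun s => x s - x 0 := by
        funext s; simp [rlIntegral]
      rw [this]
      exact hx.sub continuousOn_const
    · exact ((continuousOn_rlIntegral (sub_pos.2 ha1) hyc hyC).mono Icc_subset_Ici_self).congr hJ
  have hJ0 : rlIntegral (1 - a) (fun s => x s - x 0) 0 = 0 := by simp [rlIntegral]
  have hJint : ∀ t ∈ Icc 0 T, rlIntegral (1 - a) (fun s => x s - x 0) t
      = ∫ s in (0 : ℝ)..t, h s := fun t ht => by
    rw [intervalIntegral.integral_eq_sub_of_hasDerivAt_of_le ht.1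
      (hJc.mono (Icc_subset_Icc_right ht.2)) (fun s hs => hD s ⟨hs.1, hs.2.trans_le ht.2⟩)
      (hc.intervalIntegrable 0 t), hJ0, sub_zero]
  rcases ha1.eq_or_lt with rfl | ha1
  · have := hJint t ht
    rw [rlIntegral_one, ← this]
    simp [rlIntegral]
  have hyk : ∀ t ∈ Icc 0 T, ∫ s in (0 : ℝ)..t, y s = ∫ s in (0 : ℝ)..t, k s := fun t ht => by
    rw [← rlIntegral_rlIntegral ha (sub_pos.2 ha1) (by ring) hyc hyC ht.1,
      ← rlIntegral_rlIntegral ha (sub_pos.2 ha1) (by ring) hkc hkC ht.1]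
    refine rlIntegral_congr ht.1 fun s hs => ?_
    have hs' : s ∈ Icc 0 T := ⟨hs.1, hs.2.trans ht.2⟩
    rw [← hJ s hs', hJint s hs', ← rlIntegral_rlIntegral (sub_pos.2 ha1) ha (by ring) hc hB hs.1]
    exact rlIntegral_congr hs.1 fun u hu => (hk u ⟨hu.1, hu.2.trans hs'.2⟩).symm
  have hint : ∀ t ∈ Ioo 0 T, y t = k t := fun t ht => by
    have h1 := intervalIntegral.integral_hasDerivAt_right (hyc.intervalIntegrable 0 t)
      (hyc.stronglyMeasurableAtFilter _ _) hyc.continuousAt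
    have h2 := intervalIntegral.integral_hasDerivAt_right (hkc.intervalIntegrable 0 t)
      (hkc.stronglyMeasurableAtFilter _ _) hkc.continuousAt
    refine h1.unique (h2.congr_of_eventuallyEq ?_)
    filter_upwards [Icc_mem_nhds ht.1 ht.2] with s hs using hyk s hs
  have hcl : EqOn y k (closure (Ioo 0 T)) := EqOn.closure hint hyc hkc
  rw [closure_Ioo hT'.ne] at hcl
  have := hcl ht
  rw [hy t ht, hk t ht] at this
  linarith

/-! ### Homogeneous and cooperative vector fields. -/

namespace IsHomogeneousOfDegree

variable {d : ℕ} {p : ℝ} {f : (Fin d → ℝ) → (Fin d → ℝ)}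

theorem map_zero (hf : IsHomogeneousOfDegree p f) (hp : 0 < p) : f 0 = 0 := by
  have h := hf 0 2 two_pos
  rw [smul_zero] at h
  have h2 : (1 : ℝ) < 2 ^ p := Real.one_lt_rpow one_lt_two hp
  have h3 : ((2 : ℝ) ^ p - 1) • f 0 = 0 := by rw [sub_smul, one_smul, ← h, sub_self]
  exact (smul_eq_zero.1 h3).resolve_left (by linarith)

theorem fderiv_smul (hf : IsHomogeneousOfDegree p f) (hd : ContDiffOn ℝ 1 f {0}ᶜ)
    {x : Fin d → ℝ} (hx : x ≠ 0) {c : ℝ} (hc : 0 < c) :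
    fderiv ℝ f (c • x) = c ^ (p - 1) • fderiv ℝ f x := by
  have hdiff : ∀ y, y ≠ 0 → DifferentiableAt ℝ f y := fun y hy =>
    (hd.differentiableOn one_ne_zero).differentiableAt (isOpen_compl_singleton.mem_nhds hy)
  have hcx : c • x ≠ 0 := smul_ne_zero hc.ne' hx
  have h1 : HasFDerivAt (fun y => f (c • y))
      ((fderiv ℝ f (c • x)).comp (c • ContinuousLinearMap.id ℝ (Fin d → ℝ))) x := by
    have h0 : HasFDerivAt (fun y : Fin d → ℝ => c • y)
        (c • ContinuousLinearMap.id ℝ (Fin d → ℝ)) x :=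
      (c • ContinuousLinearMap.id ℝ (Fin d → ℝ)).hasFDerivAt
    exact (hdiff _ hcx).hasFDerivAt.comp x h0
  have h2 : HasFDerivAt (fun y => f (c • y)) (c ^ p • fderiv ℝ f x) x := by
    have : (fun y => f (c • y)) = fun y => c ^ p • f y := funext fun y => hf y c hc
    rw [this]
    exact (hdiff x hx).hasFDerivAt.const_smul (c ^ p)
  have h3 := h1.unique h2
  ext1 w
  have h4 := DFunLike.congr_fun h3 w
  simp only [ContinuousLinearMap.comp_apply, _root_.smul_apply,
    ContinuousLinearMap.id_apply, _root_.map_smul] at h4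
  rw [Real.rpow_sub_one hc.ne', _root_.smul_apply, div_eq_inv_mul, mul_smul, ← h4,
    inv_smul_smul₀ hc.ne']

theorem exists_norm_le (hf : IsHomogeneousOfDegree p f) (hp : 0 < p)
    (hd : ContDiffOn ℝ 1 f {0}ᶜ) : ∃ C, 0 ≤ C ∧ ∀ x, ‖f x‖ ≤ C * ‖x‖ ^ p := by
  have hsub : Metric.sphere (0 : Fin d → ℝ) 1 ⊆ {0}ᶜ := fun x hx h0 => by
    rw [mem_singleton_iff.1 h0] at hx; simp at hx
  obtain ⟨C, hC⟩ := (isCompact_sphere (0 : Fin d → ℝ) 1).exists_bound_of_continuousOn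
    (hd.continuousOn.mono hsub)
  refine ⟨max C 0, le_max_right _ _, fun x => ?_⟩
  rcases eq_or_ne x 0 with rfl | hx
  · rw [hf.map_zero hp, norm_zero]
    positivity
  have hn : 0 < ‖x‖ := norm_pos_iff.2 hx
  have h1 := hf (‖x‖⁻¹ • x) ‖x‖ hn
  rw [smul_inv_smul₀ hn.ne'] at h1
  rw [h1, norm_smul, Real.norm_of_nonneg (by positivity), mul_comm]
  gcongr
  exact (hC _ (by simp [norm_smul, hn.ne'])).trans (le_max_left _ _)

theorem exists_norm_fderiv_le (hf : IsHomogeneousOfDegree p f)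
    (hd : ContDiffOn ℝ 1 f {0}ᶜ) :
    ∃ C, 0 ≤ C ∧ ∀ x, x ≠ 0 → ‖fderiv ℝ f x‖ ≤ C * ‖x‖ ^ (p - 1) := by
  have hsub : Metric.sphere (0 : Fin d → ℝ) 1 ⊆ {0}ᶜ := fun x hx h0 => by
    rw [mem_singleton_iff.1 h0] at hx; simp at hx
  obtain ⟨C, hC⟩ := (isCompact_sphere (0 : Fin d → ℝ) 1).exists_bound_of_continuousOn
    ((hd.continuousOn_fderiv_of_isOpen isOpen_compl_singleton le_rfl).mono hsub)
  refine ⟨max C 0, le_max_right _ _, fun x hx => ?_⟩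
  have hn : 0 < ‖x‖ := norm_pos_iff.2 hx
  have h1 := hf.fderiv_smul hd (x := ‖x‖⁻¹ • x) (smul_ne_zero (inv_ne_zero hn.ne') hx) hn
  rw [smul_inv_smul₀ hn.ne'] at h1
  rw [h1, norm_smul, Real.norm_of_nonneg (by positivity), mul_comm]
  gcongr
  exact (hC _ (by simp [norm_smul, hn.ne'])).trans (le_max_left _ _)

/-- A homogeneous map of degree at least one that is `C¹` away from the origin is Lipschitz on
bounded sets. -/
theorem exists_lipschitz_on_ball (hf : IsHomogeneousOfDegree p f) (hp : 1 ≤ p)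
    (hd : ContDiffOn ℝ 1 f {0}ᶜ) (R : ℝ) :
    ∃ K, 0 ≤ K ∧ ∀ x y, ‖x‖ ≤ R → ‖y‖ ≤ R → ‖f x - f y‖ ≤ K * ‖x - y‖ := by
  obtain ⟨C, hC0, hC⟩ := hf.exists_norm_le (by linarith) hd
  obtain ⟨C', hC0', hC'⟩ := hf.exists_norm_fderiv_le hd
  have hpow : ∀ x : Fin d → ℝ, ‖x‖ ≤ R → ‖x‖ ^ (p - 1) ≤ R ^ (p - 1) := fun x hx =>
    Real.rpow_le_rpow (norm_nonneg _) hx (by linarith)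
  have hlin : ∀ x : Fin d → ℝ, ‖x‖ ≤ R → ‖f x‖ ≤ C * R ^ (p - 1) * ‖x‖ := fun x hx => by
    rcases eq_or_ne x 0 with rfl | h0
    · rw [hf.map_zero (by linarith)]; simp
    have h1 : ‖x‖ ^ p = ‖x‖ ^ (p - 1) * ‖x‖ := by
      rw [Real.rpow_sub_one (norm_ne_zero_iff.2 h0), div_mul_cancel₀ _ (norm_ne_zero_iff.2 h0)]
    have := hC x
    rw [h1] at this
    refine this.trans ?_
    rw [← mul_assoc]
    have := hpow x hx
    gcongr
  refine ⟨max 0 (max (C * R ^ (p - 1)) (C' * R ^ (p - 1))), le_max_left _ _,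
    fun x y hx hy => ?_⟩
  -- Differentiability may fail at the origin, so the mean value inequality is available only off
  -- it. If the segment meets the origin, then `‖x - y‖ = ‖x‖ + ‖y‖` and the linear growth bound
  -- replaces it.
  by_cases h0 : (0 : Fin d → ℝ) ∈ segment ℝ y x
  · have hxy : ‖x - y‖ = ‖x‖ + ‖y‖ := by
      have := dist_add_dist_of_mem_segment h0
      rw [dist_zero_right, dist_zero_left, dist_comm, dist_eq_norm] at this
      linarith
    calc ‖f x - f y‖ ≤ ‖f x‖ + ‖f y‖ := norm_sub_le _ _
      _ ≤ C * R ^ (p - 1) * ‖x‖ + C * R ^ (p - 1) * ‖y‖ := add_le_add (hlin x hx) (hlin y hy)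
      _ = C * R ^ (p - 1) * ‖x - y‖ := by rw [hxy, mul_add]
      _ ≤ _ := by
        gcongr
        exact (le_max_left _ _).trans (le_max_right _ _)
  · have hball : segment ℝ y x ⊆ Metric.closedBall 0 R :=
      (convex_closedBall 0 R).segment_subset (by simpa using hy) (by simpa using hx)
    have := (convex_segment (𝕜 := ℝ) y x).norm_image_sub_le_of_norm_hasFDerivWithin_le
      (f := f) (f' := fun z => fderiv ℝ f z) (C := C' * R ^ (p - 1)) (fun z hz => ?_)
      (fun z hz => ?_) (left_mem_segment ℝ y x) (right_mem_segment ℝ y x)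
    · refine this.trans ?_
      gcongr
      exact (le_max_right _ _).trans (le_max_right _ _)
    · have hz0 : z ≠ 0 := fun h => h0 (h ▸ hz)
      exact ((hd.differentiableOn one_ne_zero).differentiableAt
        (isOpen_compl_singleton.mem_nhds hz0)).hasFDerivAt.hasFDerivWithinAt
    · have hz0 : z ≠ 0 := fun h => h0 (h ▸ hz)
      refine (hC' z hz0).trans ?_
      have := hpow z (by simpa using hball hz)
      gcongr

end IsHomogeneousOfDegree

/-- The Kamke condition for cooperative vector fields on the nonnegative orthant. -/
theorem IsCooperative.apply_le_apply {d : ℕ} {f : (Fin d → ℝ) → (Fin d → ℝ)}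
    (hf : IsCooperative f) {x y : Fin d → ℝ} (hx : 0 ≤ x) (hxy : x ≤ y) {i : Fin d}
    (hi : x i = y i) : f x i ≤ f y i := by
  rcases eq_or_ne y 0 with rfl | hy
  · rw [le_antisymm hxy hx]
  set P : ℝ → Fin d → ℝ := fun s => x + s • (y - x) with hP
  have hPc : Continuous P := by fun_prop
  have hPd : ∀ s, HasDerivAt P (y - x) s := fun s => by
    have := ((hasDerivAt_id s).smul_const (y - x)).const_add x
    rwa [one_smul] at this
  have hder : ∀ s ∈ Ioo (0 : ℝ) 1,
      HasDerivAt (fun s => f (P s) i) (fderiv ℝ f (P s) (y - x) i) s ∧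
        0 ≤ fderiv ℝ f (P s) (y - x) i := by
    intro s hs
    have hP0 : 0 ≤ P s := add_nonneg hx (smul_nonneg hs.1.le (sub_nonneg.2 hxy))
    have hPne : P s ≠ 0 := fun h0 => hy <| by
      funext j
      have h1 : x j + s * (y j - x j) = 0 := congrFun h0 j
      have h2 : 0 ≤ x j := hx j
      have h3 : x j ≤ y j := hxy j
      have h4 := mul_nonneg hs.1.le (sub_nonneg.2 h3)
      have h5 : s * (y j - x j) = 0 := by linarith
      have h6 := (mul_eq_zero.1 h5).resolve_left hs.1.ne'
      simp only [Pi.zero_apply]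
      linarith
    constructor
    · have h1 := ((hf.contDiffOn.differentiableOn one_ne_zero).differentiableAt
        (isOpen_compl_singleton.mem_nhds hPne)).hasFDerivAt.comp_hasDerivAt s (hPd s)
      exact (hasDerivAt_pi.1 h1) i
    -- The diagonal Jacobian entry is multiplied by `y i - x i = 0`, so only the nonnegative
    -- off-diagonal entries contribute.
    · have hsum : y - x = ∑ j, (y j - x j) • (Pi.single j 1 : Fin d → ℝ) := by
        funext k
        simp [Finset.sum_apply, Pi.single_apply]
      rw [hsum, map_sum, Finset.sum_apply]
      refine Finset.sum_nonneg fun j _ => ?_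
      rw [map_smul, Pi.smul_apply, smul_eq_mul]
      rcases eq_or_ne i j with rfl | hij
      · rw [hi, sub_self, zero_mul]
      · exact mul_nonneg (sub_nonneg.2 (hxy j)) (hf.metzler _ hP0 hPne i j hij)
  have hmono : MonotoneOn (fun s => f (P s) i) (Icc 0 1) := by
    refine monotoneOn_of_deriv_nonneg (convex_Icc 0 1) ?_ ?_ ?_
    · exact ((continuous_apply i).comp (hf.continuous.comp hPc)).continuousOn
    · intro s hs
      rw [interior_Icc] at hs
      exact (hder s hs).1.differentiableAt.differentiableWithinAt
    · intro s hs
      rw [interior_Icc] at hs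
      rw [(hder s hs).1.deriv]
      exact (hder s hs).2
  have := hmono (left_mem_Icc.2 zero_le_one) (right_mem_Icc.2 zero_le_one) zero_le_one
  simpa [hP] using this

/-! ### Existence and uniqueness for the delay system in Volterra form. -/

/-- Right-hand side `f (w s) + ∑ⱼ gⱼ (w (s - τⱼ s))` of the delay system, `i`-th component. -/
def delayField {d m : ℕ} (f : (Fin d → ℝ) → (Fin d → ℝ)) (g : Fin m → (Fin d → ℝ) → (Fin d → ℝ))
    (τ : Fin m → ℝ → ℝ) (w : ℝ → Fin d → ℝ) (i : Fin d) (s : ℝ) : ℝ :=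
  f (w s) i + ∑ j, g j (w (s - τ j s)) i

section delayField

variable {d m : ℕ} {f : (Fin d → ℝ) → (Fin d → ℝ)} {g : Fin m → (Fin d → ℝ) → (Fin d → ℝ)}
  {τ : Fin m → ℝ → ℝ}

theorem continuousOn_delayField (hf : Continuous f) (hg : ∀ j, Continuous (g j)) {r T : ℝ}
    (hr : 0 ≤ r) (hτc : ∀ j, ContinuousOn (τ j) (Ici 0))
    (hτ : ∀ j t, 0 ≤ t → τ j t ∈ Icc 0 r) {w : ℝ → Fin d → ℝ}
    (hw : ContinuousOn w (Icc (-r) T)) (i : Fin d) :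
    ContinuousOn (delayField f g τ w i) (Icc 0 T) := by
  refine ContinuousOn.add ?_ (continuousOn_finsetSum _ fun j _ => ?_)
  · exact (continuous_apply i).comp_continuousOn
      (hf.comp_continuousOn (hw.mono (Icc_subset_Icc_left (by linarith))))
  · refine (continuous_apply i).comp_continuousOn ((hg j).comp_continuousOn (hw.comp
      (continuousOn_id.sub ((hτc j).mono Icc_subset_Ici_self)) fun s hs => ?_))
    have := hτ j s hs.1
    exact ⟨by linarith [this.2, hs.1], by linarith [this.1, hs.2]⟩

theorem abs_delayField_sub_le {S : Set (Fin d → ℝ)} {K D s : ℝ} (hK : 0 ≤ K)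
    (hf : ∀ x ∈ S, ∀ y ∈ S, ‖f x - f y‖ ≤ K * ‖x - y‖)
    (hg : ∀ j, ∀ x ∈ S, ∀ y ∈ S, ‖g j x - g j y‖ ≤ K * ‖x - y‖) {w w' : ℝ → Fin d → ℝ}
    (hw : w s ∈ S) (hwj : ∀ j, w (s - τ j s) ∈ S) (hw' : w' s ∈ S)
    (hwj' : ∀ j, w' (s - τ j s) ∈ S) (hD : ‖w s - w' s‖ ≤ D)
    (hDj : ∀ j, ‖w (s - τ j s) - w' (s - τ j s)‖ ≤ D) (i : Fin d) :
    |delayField f g τ w i s - delayField f g τ w' i s| ≤ K * (1 + m) * D := by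
  have h1 : |f (w s) i - f (w' s) i| ≤ K * D :=
    (norm_le_pi_norm (f (w s) - f (w' s)) i).trans
      ((hf _ hw _ hw').trans (mul_le_mul_of_nonneg_left hD hK))
  have h2 : |∑ j, (g j (w (s - τ j s)) i - g j (w' (s - τ j s)) i)| ≤ m * (K * D) := by
    refine (Finset.abs_sum_le_sum_abs _ _).trans ?_
    calc _ ≤ ∑ _j : Fin m, K * D := Finset.sum_le_sum fun j _ =>
          (norm_le_pi_norm (g j (w (s - τ j s)) - g j (w' (s - τ j s))) i).trans
            ((hg j _ (hwj j) _ (hwj' j)).trans (mul_le_mul_of_nonneg_left (hDj j) hK))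
      _ = _ := by simp
  have h3 : delayField f g τ w i s - delayField f g τ w' i s = (f (w s) i - f (w' s) i) +
      ∑ j, (g j (w (s - τ j s)) i - g j (w' (s - τ j s)) i) := by
    rw [Finset.sum_sub_distrib, delayField, delayField]
    ring
  rw [h3]
  refine (abs_add_le _ _).trans ((add_le_add h1 h2).trans (le_of_eq (by ring)))

theorem abs_delayField_le {B : ℝ} (hf : ∀ x, ‖f x‖ ≤ B) (hg : ∀ j x, ‖g j x‖ ≤ B)
    (w : ℝ → Fin d → ℝ) (i : Fin d) (s : ℝ) : |delayField f g τ w i s| ≤ B * (1 + m) := by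
  refine (abs_add_le _ _).trans ?_
  have h2 : |∑ j, g j (w (s - τ j s)) i| ≤ m * B := by
    refine (Finset.abs_sum_le_sum_abs _ _).trans ?_
    calc _ ≤ ∑ _j : Fin m, B :=
          Finset.sum_le_sum fun j _ => (norm_le_pi_norm _ i).trans (hg j _)
      _ = _ := by simp
  have h1 : |f (w s) i| ≤ B := (norm_le_pi_norm _ i).trans (hf _)
  linarith

end delayField

theorem exists_rate {d : ℕ} {α : Fin d → ℝ} (hα : ∀ i, 0 < α i) (C : ℝ) :
    ∃ l : ℝ, 1 ≤ l ∧ ∀ i, C ≤ l ^ α i := by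
  have h : ∀ᶠ l : ℝ in atTop, ∀ i, C ≤ l ^ α i :=
    eventually_all.2 fun i => (tendsto_rpow_atTop (hα i)).eventually_ge_atTop C
  obtain ⟨l, h1, h2⟩ := ((eventually_ge_atTop (1 : ℝ)).and h).exists
  exact ⟨l, h1, h2⟩

/-- Global solvability of the Volterra form of the delay system for bounded, globally Lipschitz
vector fields. -/
theorem exists_volterra_solution {d m : ℕ} {α : Fin d → ℝ} (hα : ∀ i, 0 < α i)
    {f : (Fin d → ℝ) → (Fin d → ℝ)} {g : Fin m → (Fin d → ℝ) → (Fin d → ℝ)} {τ : Fin m → ℝ → ℝ}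
    (hτc : ∀ j, Continuous (τ j)) (hτ : ∀ j t, 0 ≤ τ j t) {K B : ℝ} (hK : 0 ≤ K)
    (hf : ∀ x y, ‖f x - f y‖ ≤ K * ‖x - y‖) (hg : ∀ j x y, ‖g j x - g j y‖ ≤ K * ‖x - y‖)
    (hfB : ∀ x, ‖f x‖ ≤ B) (hgB : ∀ j x, ‖g j x‖ ≤ B) {φ : ℝ → Fin d → ℝ} (hφ : Continuous φ)
    {C : ℝ} (hC : ∀ s, ‖φ s‖ ≤ C) :
    ∃ w : ℝ → Fin d → ℝ, Continuous w ∧ (∀ t ≤ 0, w t = φ t) ∧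
      (∀ i, Continuous (delayField f g τ w i)) ∧
      ∀ t, 0 ≤ t → ∀ i, w t i = φ 0 i + rlIntegral (α i) (delayField f g τ w i) t := by
  obtain ⟨l, hl1, hl⟩ := exists_rate hα (2 * (K * (1 + m)))
  have hl0 : 0 < l := by linarith
  have hfc : Continuous f := (LipschitzWith.of_dist_le_mul (K := K.toNNReal) fun x y => by
    rw [dist_eq_norm, dist_eq_norm, Real.coe_toNNReal K hK]; exact hf x y).continuous
  have hgc : ∀ j, Continuous (g j) := fun j =>
    (LipschitzWith.of_dist_le_mul (K := K.toNNReal) fun x y => by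
      rw [dist_eq_norm, dist_eq_norm, Real.coe_toNNReal K hK]; exact hg j x y).continuous
  have hB0 : 0 ≤ B := (norm_nonneg _).trans (hfB 0)
  -- The unknown is `u = exp (-l t) w`, for which the sup norm is the weighted norm of `w`; `W`
  -- restores `w` from `u`. The truncations `max` and `min` with `0` in `W` and `N` treat history
  -- and future by one formula on the whole line.
  set W : (ℝ → Fin d → ℝ) → ℝ → Fin d → ℝ := fun u s => Real.exp (l * max s 0) • u s with hW
  have hWc : ∀ u, Continuous u → Continuous (W u) := fun u hu => by
    simp only [hW]; fun_prop
  have hhc : ∀ w : ℝ → Fin d → ℝ, Continuous w → ∀ i, Continuous (delayField f g τ w i) := by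
    intro w hw i
    unfold delayField
    fun_prop
  have hhB := fun w : ℝ → Fin d → ℝ => abs_delayField_le (τ := τ) hfB hgB w
  set N : (ℝ → Fin d → ℝ) → ℝ → Fin d → ℝ := fun u t i => Real.exp (-(l * max t 0)) *
    (φ (min t 0) i + rlIntegral (α i) (delayField f g τ (W u) i) (max t 0)) with hN
  have hNc : ∀ u, Continuous u → Continuous (N u) := fun u hu => by
    refine continuous_pi fun i => ?_
    refine Continuous.mul (by fun_prop) (Continuous.add (by fun_prop) ?_)
    exact (continuousOn_rlIntegral (hα i) (hhc _ (hWc u hu) i) (hhB _ i)).comp_continuous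
      (by fun_prop) fun t => mem_Ici.2 (le_max_right _ _)
  have hpow : ∀ i, 1 ≤ l ^ α i := fun i => Real.one_le_rpow hl1 (hα i).le
  have hexp : ∀ t : ℝ, Real.exp (-(l * max t 0)) * Real.exp (l * max t 0) = 1 := fun t => by
    rw [← Real.exp_add, neg_add_cancel, Real.exp_zero]
  have hexp1 : ∀ t : ℝ, 0 ≤ t → 1 ≤ Real.exp (l * t) := fun t ht =>
    Real.one_le_exp (by positivity)
  have hC0 : 0 ≤ C := (norm_nonneg _).trans (hC 0)
  have hNB : ∀ u, Continuous u → ∀ t, ‖N u t‖ ≤ C + B * (1 + m) := fun u hu t => by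
    have hC0' : 0 ≤ C + B * (1 + m) := by positivity
    refine (pi_norm_le_iff_of_nonneg hC0').2 fun i => ?_
    have ht : 0 ≤ max t 0 := le_max_right _ _
    have h1 := abs_rlIntegral_le (C := B * (1 + m)) (hα i) hl0 ht (by positivity)
      (hhc _ (hWc u hu) i) fun s hs => (hhB _ i s).trans
        (le_mul_of_one_le_right (by positivity) (hexp1 s hs.1))
    have h2 : B * (1 + m) * Real.exp (l * max t 0) / l ^ α i
        ≤ B * (1 + m) * Real.exp (l * max t 0) := div_le_self (by positivity) (hpow i)
    have h3 : |φ (min t 0) i| ≤ C * Real.exp (l * max t 0) :=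
      ((norm_le_pi_norm _ i).trans (hC _)).trans (le_mul_of_one_le_right hC0 (hexp1 _ ht))
    simp only [hN, Real.norm_eq_abs]
    rw [abs_mul, Real.abs_exp]
    calc _ ≤ Real.exp (-(l * max t 0)) * ((C + B * (1 + m)) * Real.exp (l * max t 0)) := by
          gcongr
          exact (abs_add_le _ _).trans (by linarith)
      _ = (C + B * (1 + m)) * (Real.exp (-(l * max t 0)) * Real.exp (l * max t 0)) := by ring
      _ = _ := by rw [hexp, mul_one]
  let T : BoundedContinuousFunction ℝ (Fin d → ℝ) → BoundedContinuousFunction ℝ (Fin d → ℝ) :=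
    fun u => BoundedContinuousFunction.ofNormedAddCommGroup (N u) (hNc u u.continuous)
      (C + B * (1 + m)) (hNB u u.continuous)
  have hT : ContractingWith (1 / 2) T := by
    refine ⟨by norm_num, LipschitzWith.of_dist_le_mul fun u u' => ?_⟩
    refine (BoundedContinuousFunction.dist_le (by positivity)).2 fun t => ?_
    rw [dist_eq_norm]
    refine (pi_norm_le_iff_of_nonneg (by positivity)).2 fun i => ?_
    have ht : 0 ≤ max t 0 := le_max_right _ _
    -- The weight is nondecreasing, so a delayed argument `s - τ ≤ s` obeys the same bound as `s`.
    have hWd : ∀ s b, s ≤ b → 0 ≤ b → ‖W u s - W u' s‖ ≤ dist u u' * Real.exp (l * b) := by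
      intro s b hsb hb
      simp only [hW]
      rw [← smul_sub, norm_smul, Real.norm_eq_abs, Real.abs_exp, mul_comm]
      have h1 : ‖u s - u' s‖ ≤ dist u u' := by
        rw [← dist_eq_norm]; exact BoundedContinuousFunction.dist_coe_le_dist s
      have : max s 0 ≤ b := max_le hsb hb
      gcongr
    have hd : ∀ s ∈ Icc 0 (max t 0), |delayField f g τ (W u) i s - delayField f g τ (W u') i s|
        ≤ K * (1 + m) * dist u u' * Real.exp (l * s) := fun s hs => by
      rw [mul_assoc]
      exact abs_delayField_sub_le (S := univ) hK (fun x _ y _ => hf x y) (fun j x _ y _ => hg j x y)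
        (mem_univ _) (fun _ => mem_univ _) (mem_univ _) (fun _ => mem_univ _)
        (hWd s s le_rfl hs.1) (fun j => hWd _ s (by linarith [hτ j s]) hs.1) i
    have hu := hhc _ (hWc u u.continuous) i
    have hu' := hhc _ (hWc u' u'.continuous) i
    have h1 := abs_rlIntegral_le (hα i) hl0 ht (by positivity) (hu.sub hu') hd
    rw [rlIntegral_sub (hα i) hu hu'] at h1
    have h2 : K * (1 + m) * dist u u' * Real.exp (l * max t 0) / l ^ α i
        ≤ 1 / 2 * dist u u' * Real.exp (l * max t 0) := by
      rw [div_le_iff₀ (by linarith [hpow i])]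
      have := mul_le_mul_of_nonneg_right (hl i)
        (by positivity : 0 ≤ dist u u' * Real.exp (l * max t 0))
      linarith
    have h3 : (T u t - T u' t) i = Real.exp (-(l * max t 0)) *
        (rlIntegral (α i) (delayField f g τ (W u) i) (max t 0) -
          rlIntegral (α i) (delayField f g τ (W u') i) (max t 0)) := by
      simp only [T, hN, BoundedContinuousFunction.coe_ofNormedAddCommGroup, Pi.sub_apply]
      ring
    rw [h3, Real.norm_eq_abs, abs_mul, Real.abs_exp]
    calc _ ≤ Real.exp (-(l * max t 0)) * (1 / 2 * dist u u' * Real.exp (l * max t 0)) := by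
          gcongr
          exact h1.trans h2
      _ = 1 / 2 * dist u u' * (Real.exp (-(l * max t 0)) * Real.exp (l * max t 0)) := by ring
      _ = _ := by rw [hexp, mul_one]; simp
  set u := hT.fixedPoint T with hu
  have hfix : ∀ t, N u t = u t := fun t =>
    DFunLike.congr_fun (hT.fixedPoint_isFixedPt : T u = u) t
  have hWu : ∀ t i, W u t i
      = φ (min t 0) i + rlIntegral (α i) (delayField f g τ (W u) i) (max t 0) := fun t i => by
    have h1 : W u t i = Real.exp (l * max t 0) * N u t i := by
      rw [hfix]; rfl
    rw [h1]
    simp only [hN]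
    rw [← mul_assoc, mul_comm (Real.exp _), hexp, one_mul]
  refine ⟨W u, hWc u u.continuous, fun t ht => ?_, hhc _ (hWc u u.continuous), fun t ht i => ?_⟩
  · funext i
    rw [hWu, max_eq_right ht, min_eq_left ht, rlIntegral_zero_right (hα i), add_zero]
  · rw [hWu, max_eq_left ht, min_eq_right ht]

/-- Uniqueness for the Volterra form of the delay system with locally Lipschitz vector fields. -/
theorem volterra_solution_unique {d m : ℕ} {α : Fin d → ℝ} (hα : ∀ i, 0 < α i)
    {f : (Fin d → ℝ) → (Fin d → ℝ)} {g : Fin m → (Fin d → ℝ) → (Fin d → ℝ)} {τ : Fin m → ℝ → ℝ}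
    (hf : ∀ R, ∃ K, 0 ≤ K ∧ ∀ x y, ‖x‖ ≤ R → ‖y‖ ≤ R → ‖f x - f y‖ ≤ K * ‖x - y‖)
    (hg : ∀ j R, ∃ K, 0 ≤ K ∧ ∀ x y, ‖x‖ ≤ R → ‖y‖ ≤ R → ‖g j x - g j y‖ ≤ K * ‖x - y‖)
    {r T : ℝ} (hr : 0 ≤ r) (hT : 0 ≤ T) (hτ : ∀ j t, 0 ≤ t → τ j t ∈ Icc 0 r)
    {w w' : ℝ → Fin d → ℝ} (hw : ContinuousOn w (Icc (-r) T)) (hw' : ContinuousOn w' (Icc (-r) T))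
    (hh : ∀ i, ContinuousOn (delayField f g τ w i) (Icc 0 T))
    (hh' : ∀ i, ContinuousOn (delayField f g τ w' i) (Icc 0 T)) {x : Fin d → ℝ}
    (he : ∀ t ∈ Icc 0 T, ∀ i, w t i = x i + rlIntegral (α i) (delayField f g τ w i) t)
    (he' : ∀ t ∈ Icc 0 T, ∀ i, w' t i = x i + rlIntegral (α i) (delayField f g τ w' i) t)
    (h0 : ∀ s ∈ Icc (-r) 0, w s = w' s) {t : ℝ} (ht : t ∈ Icc 0 T) : w t = w' t := by
  obtain ⟨R₁, hR₁⟩ := isCompact_Icc.exists_bound_of_continuousOn hw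
  obtain ⟨R₂, hR₂⟩ := isCompact_Icc.exists_bound_of_continuousOn hw'
  set R := max R₁ R₂
  obtain ⟨K₀, hK₀, hfK⟩ := hf R
  choose k hk hgk using fun j => hg j R
  set K := K₀ + ∑ j, k j with hK
  have hks : 0 ≤ ∑ j, k j := Finset.sum_nonneg fun j _ => hk j
  have hK0 : 0 ≤ K := by positivity
  have hkK : ∀ j, k j ≤ K := fun j => by
    have := Finset.single_le_sum (fun j _ => hk j) (Finset.mem_univ j)
    linarith
  obtain ⟨l, hl1, hl⟩ := exists_rate hα (2 * (K * (1 + m)))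
  have hl0 : 0 < l := by linarith
  have hsub : Icc 0 T ⊆ Icc (-r) T := Icc_subset_Icc_left (by linarith)
  -- The maximum `M` of the weighted difference is attained; the Volterra equation at the maximiser
  -- gives `M ≤ M / 2` by the choice of `l`, hence `M = 0`.
  have hec : ContinuousOn (fun t => Real.exp (-(l * t)) * ‖w t - w' t‖) (Icc 0 T) :=
    ContinuousOn.mul (by fun_prop) ((hw.mono hsub).sub (hw'.mono hsub)).norm
  obtain ⟨b, hb, hmax⟩ := isCompact_Icc.exists_isMaxOn (nonempty_Icc.2 hT) hec
  set M := Real.exp (-(l * b)) * ‖w b - w' b‖ with hM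
  have hM0 : 0 ≤ M := by positivity
  have hnorm : ∀ s ∈ Icc 0 T, ‖w s - w' s‖ ≤ M * Real.exp (l * s) := fun s hs => by
    have h1 : Real.exp (-(l * s)) * ‖w s - w' s‖ ≤ M := hmax hs
    have h2 := mul_le_mul_of_nonneg_right h1 (Real.exp_nonneg (l * s))
    rwa [mul_right_comm, ← Real.exp_add, neg_add_cancel, Real.exp_zero, one_mul] at h2
  have hnorm' : ∀ s a, s ∈ Icc (-r) a → a ∈ Icc 0 T → ‖w s - w' s‖ ≤ M * Real.exp (l * a) := by
    intro s a hs ha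
    rcases le_total s 0 with h | h
    · rw [h0 s ⟨hs.1, h⟩, sub_self, norm_zero]
      positivity
    · refine (hnorm s ⟨h, hs.2.trans ha.2⟩).trans ?_
      have := hs.2
      gcongr
  have hd : ∀ i, ∀ s ∈ Icc 0 T, |delayField f g τ w i s - delayField f g τ w' i s|
      ≤ K * (1 + m) * M * Real.exp (l * s) := fun i s hs => by
    have hsr : s ∈ Icc (-r) s := ⟨by linarith [hs.1], le_rfl⟩
    have hsj : ∀ j, s - τ j s ∈ Icc (-r) s := fun j => by
      have := hτ j s hs.1
      exact ⟨by linarith [this.2, hs.1], by linarith [this.1]⟩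
    have hin : ∀ a ∈ Icc (-r) s, ‖w a‖ ≤ R ∧ ‖w' a‖ ≤ R := fun a ha =>
      ⟨(hR₁ a ⟨ha.1, ha.2.trans hs.2⟩).trans (le_max_left _ _),
        (hR₂ a ⟨ha.1, ha.2.trans hs.2⟩).trans (le_max_right _ _)⟩
    rw [mul_assoc]
    refine abs_delayField_sub_le (S := {x | ‖x‖ ≤ R}) hK0 (fun x hx y hy => ?_)
      (fun j x hx y hy => ?_) (hin s hsr).1 (fun j => (hin _ (hsj j)).1) (hin s hsr).2
      (fun j => (hin _ (hsj j)).2) (hnorm' s s hsr hs) (fun j => hnorm' _ s (hsj j) hs) i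
    · exact (hfK x y hx hy).trans (mul_le_mul_of_nonneg_right (by linarith) (norm_nonneg _))
    · exact (hgk j x y hx hy).trans (mul_le_mul_of_nonneg_right (hkK j) (norm_nonneg _))
  have hb2 : ‖w b - w' b‖ ≤ M / 2 * Real.exp (l * b) := by
    refine (pi_norm_le_iff_of_nonneg (by positivity)).2 fun i => ?_
    obtain ⟨y, hyc, -, hy⟩ := exists_bounded_continuous_extension hT (hh i)
    obtain ⟨y', hyc', -, hy'⟩ := exists_bounded_continuous_extension hT (hh' i)
    have hmem : ∀ s ∈ Icc 0 b, s ∈ Icc 0 T := fun s hs => ⟨hs.1, hs.2.trans hb.2⟩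
    have h1 := abs_rlIntegral_le (C := K * (1 + m) * M) (hα i) hl0 hb.1 (by positivity)
      (hyc.sub hyc') fun s hs => by
        simp only [Pi.sub_apply]
        rw [hy s (hmem s hs), hy' s (hmem s hs)]; exact hd i s (hmem s hs)
    rw [rlIntegral_sub (hα i) hyc hyc'] at h1
    have h2 : (w b - w' b) i = rlIntegral (α i) y b - rlIntegral (α i) y' b := by
      rw [Pi.sub_apply, he b hb, he' b hb, rlIntegral_congr hb.1 fun s hs => hy s (hmem s hs),
        rlIntegral_congr hb.1 fun s hs => hy' s (hmem s hs)]
      ring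
    rw [h2]
    refine h1.trans ?_
    rw [div_le_iff₀ (by positivity)]
    have := mul_le_mul_of_nonneg_right (hl i) (by positivity : 0 ≤ M * Real.exp (l * b))
    linarith
  have hMle : M ≤ M / 2 := by
    calc M ≤ Real.exp (-(l * b)) * (M / 2 * Real.exp (l * b)) := by
          rw [hM]; gcongr
      _ = M / 2 * (Real.exp (-(l * b)) * Real.exp (l * b)) := by ring
      _ = M / 2 := by rw [← Real.exp_add, neg_add_cancel, Real.exp_zero, mul_one]
  have hMz : M = 0 := by linarith
  have := hnorm t ht
  rw [hMz, zero_mul] at this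
  exact sub_eq_zero.1 (norm_le_zero_iff.1 this)

/-- A solution of the delay system satisfies its Volterra form. -/
theorem IsDelaySolution.volterra {d m : ℕ} {α : Fin d → ℝ} (hα : ∀ i, 0 < α i ∧ α i ≤ 1)
    {f : (Fin d → ℝ) → (Fin d → ℝ)} {g : Fin m → (Fin d → ℝ) → (Fin d → ℝ)} {τ : Fin m → ℝ → ℝ}
    {r : ℝ} (hr : 0 ≤ r) {φ : ℝ → Fin d → ℝ} {T : EReal} {w : ℝ → Fin d → ℝ}
    (hw : IsDelaySolution α f g τ r φ T w) {b : ℝ} (hbT : (b : EReal) < T)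
    {i : Fin d} (hh : ContinuousOn (delayField f g τ w i) (Icc 0 b)) {t : ℝ} (ht : t ∈ Icc 0 b) :
    w t i = φ 0 i + rlIntegral (α i) (delayField f g τ w i) t := by
  have hb : 0 ≤ b := ht.1.trans ht.2
  obtain ⟨y, hyc, ⟨B, hB⟩, hy⟩ := exists_bounded_continuous_extension hb hh
  have hwc : ContinuousOn (fun s => w s i) (Icc 0 b) :=
    (continuous_apply i).comp_continuousOn (hw.continuousOn.mono fun s hs =>
      ⟨by linarith [hs.1], (EReal.coe_le_coe_iff.2 hs.2).trans_lt hbT⟩)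
  have := volterra_of_hasCaputoDerivAt (hα i).1 (hα i).2 hwc hyc hB (fun s hs => ?_) ht
  · rw [this, hw.history 0 ⟨by linarith, le_rfl⟩]
    congr 1
    exact rlIntegral_congr ht.1 fun s hs => hy s ⟨hs.1, hs.2.trans ht.2⟩
  · rw [hy s ⟨hs.1.le, hs.2.le⟩]
    exact hw.equation s hs.1 ((EReal.coe_lt_coe_iff.2 hs.2).trans hbT) i

/-! ### Invariant boxes. -/

/-- Invariance of the box `[0, c v]` for the delay system, together with global existence and
uniqueness. -/
theorem exists_isUniqueGlobalSolution_mem_box {d m : ℕ} {α : Fin d → ℝ}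
    (hα : ∀ i, 0 < α i ∧ α i ≤ 1) {r : ℝ} (hr : 0 ≤ r) {τ : Fin m → ℝ → ℝ}
    (hτc : ∀ j, ContinuousOn (τ j) (Ici 0)) (hτ : ∀ j t, 0 ≤ t → τ j t ∈ Icc 0 r)
    {f : (Fin d → ℝ) → (Fin d → ℝ)} {p : ℝ} (hp : 1 ≤ p)
    (hf : IsCooperative f) (hfp : IsHomogeneousOfDegree p f)
    {g : Fin m → (Fin d → ℝ) → (Fin d → ℝ)} {q : Fin m → ℝ} (hq : ∀ j, 1 ≤ q j)
    (hgd : ∀ j, ContDiffOn ℝ 1 (g j) {0}ᶜ)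
    (hg : ∀ j, IsOrderPreserving (g j)) (hgq : ∀ j, IsHomogeneousOfDegree (q j) (g j))
    {V : Fin d → ℝ} (hV : 0 ≤ V) (hS : ∀ i, f V i + ∑ j, g j V i ≤ 0)
    {φ : ℝ → Fin d → ℝ} (hφc : ContinuousOn φ (Icc (-r) 0))
    (hφ : ∀ s ∈ Icc (-r) 0, φ s ∈ Icc 0 V) :
    ∃ w : ℝ → Fin d → ℝ, IsUniqueGlobalSolution α f g τ r φ w ∧
      ∀ t, 0 ≤ t → w t ∈ Icc 0 V := by
  have hα0 : ∀ i, 0 < α i := fun i => (hα i).1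
  have hf0 : f 0 = 0 := hfp.map_zero (by linarith)
  have hg0 : ∀ j, g j 0 = 0 := fun j => (hgq j).map_zero (by linarith [hq j])
  have hfL := hfp.exists_lipschitz_on_ball hp hf.contDiffOn
  have hgL := fun j => (hgq j).exists_lipschitz_on_ball (hq j) (hgd j)
  have hgc : ∀ j, Continuous (g j) := fun j => by
    refine continuous_iff_continuousAt.2 fun x => ?_
    obtain ⟨K, -, hK⟩ := hgL j (‖x‖ + 1)
    refine continuousAt_of_locally_lipschitz one_pos K fun y hy => ?_
    rw [dist_eq_norm] at hy
    rw [dist_eq_norm, dist_eq_norm]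
    have : ‖y‖ ≤ ‖x‖ + ‖y - x‖ := by simpa using norm_add_le x (y - x)
    exact hK y x (by linarith) (by linarith)
  -- `P` is the coordinatewise clamp onto the box. It is 1-Lipschitz in the sup norm, so local
  -- Lipschitz constants on the ball of radius `‖V‖` become global ones for the clamped fields.
  set P : (Fin d → ℝ) → Fin d → ℝ := fun x => 0 ⊔ (x ⊓ V) with hP
  have hPi : ∀ x i, P x i = max 0 (min (x i) (V i)) := fun x i => rfl
  have hPmem : ∀ x, P x ∈ Icc 0 V := fun x => ⟨le_sup_left, sup_le hV inf_le_right⟩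
  have hPid : ∀ x ∈ Icc 0 V, P x = x := fun x hx => by
    simp only [hP, inf_eq_left.2 hx.2, sup_eq_right.2 hx.1]
  have hPL : ∀ x y, ‖P x - P y‖ ≤ ‖x - y‖ := fun x y => by
    refine (pi_norm_le_iff_of_nonneg (norm_nonneg _)).2 fun i => ?_
    rw [Pi.sub_apply, hPi, hPi, Real.norm_eq_abs, max_comm 0, max_comm 0]
    refine (abs_max_sub_max_le_abs _ _ _).trans ?_
    exact (abs_min_sub_min_le_max _ _ _ _).trans
      (max_le (norm_le_pi_norm (x - y) i) (by simp))
  have hPR : ∀ x, ‖P x‖ ≤ ‖V‖ := fun x => by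
    refine (pi_norm_le_iff_of_nonneg (norm_nonneg _)).2 fun i => ?_
    rw [Real.norm_of_nonneg ((hPmem x).1 i)]
    exact ((hPmem x).2 i).trans ((le_abs_self _).trans (norm_le_pi_norm V i))
  obtain ⟨K₀, hK₀, hfK⟩ := hfL ‖V‖
  choose k hk hgk using fun j => hgL j ‖V‖
  set K := K₀ + ∑ j, k j with hK
  have hks : 0 ≤ ∑ j, k j := Finset.sum_nonneg fun j _ => hk j
  have hK0 : 0 ≤ K := by positivity
  have hkK : ∀ j, k j ≤ K := fun j => by
    have := Finset.single_le_sum (fun j _ => hk j) (Finset.mem_univ j)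
    linarith
  have hfP : ∀ x y, ‖f (P x) - f (P y)‖ ≤ K * ‖x - y‖ := fun x y =>
    (hfK _ _ (hPR x) (hPR y)).trans
      (mul_le_mul (by linarith) (hPL x y) (norm_nonneg _) hK0)
  have hgP : ∀ j x y, ‖g j (P x) - g j (P y)‖ ≤ K * ‖x - y‖ := fun j x y =>
    (hgk j _ _ (hPR x) (hPR y)).trans (mul_le_mul (hkK j) (hPL x y) (norm_nonneg _) hK0)
  have hfB : ∀ x, ‖f (P x)‖ ≤ K * ‖V‖ := fun x => by
    have := hfK (P x) 0 (hPR x) (by simp)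
    rw [hf0, sub_zero, sub_zero] at this
    exact this.trans (mul_le_mul (by linarith) (hPR x) (norm_nonneg _) hK0)
  have hgB : ∀ j x, ‖g j (P x)‖ ≤ K * ‖V‖ := fun j x => by
    have := hgk j (P x) 0 (hPR x) (by simp)
    rw [hg0, sub_zero, sub_zero] at this
    exact this.trans (mul_le_mul (hkK j) (hPR x) (norm_nonneg _) hK0)
  have hr' : -r ≤ 0 := by linarith
  obtain ⟨φ', hφ'c, ⟨C, hC⟩, hφ'⟩ := exists_bounded_continuous_extension hr' hφc
  have h0mem : (0 : ℝ) ∈ Icc (-r) 0 := ⟨hr', le_rfl⟩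
  obtain ⟨w, hwc, hwh, hhc, hw⟩ := exists_volterra_solution (τ := fun j s => τ j (max s 0)) hα0
    (fun j => (hτc j).comp_continuous (by fun_prop) fun s => mem_Ici.2 (le_max_right _ _))
    (fun j s => (hτ j _ (le_max_right _ _)).1) hK0 hfP hgP hfB hgB hφ'c hC
  set h := delayField (fun x => f (P x)) (fun j x => g j (P x)) (fun j s => τ j (max s 0)) w with hh
  have hhB : ∀ i s, |h i s| ≤ K * ‖V‖ * (1 + m) := fun i s => abs_delayField_le hfB hgB w i s
  have hzero_mem : (0 : Fin d → ℝ) ∈ {x : Fin d → ℝ | 0 ≤ x} := le_refl (0 : Fin d → ℝ)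
  have hlow : ∀ t, 0 ≤ t → ∀ i, 0 ≤ w t i := fun t ht i => by
    rw [hw t ht i]
    refine rlIntegral_solution_nonneg (hα i).1 (hα i).2 (hhc i) (hhB i) ?_ (fun s hs hle => ?_) ht
    · rw [hφ' 0 h0mem]
      exact (hφ 0 h0mem).1 i
    · rw [← hw s hs i] at hle
      -- Where `w i ≤ 0` the clamped point lies on the face with zero `i`-th coordinate, so it can
      -- be compared with the origin, where all fields vanish.
      have h1 : (0 : Fin d → ℝ) i = P (w s) i := by
        rw [hPi, Pi.zero_apply, max_eq_left ((min_le_left _ _).trans hle)]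
      have h2 := hf.apply_le_apply le_rfl (hPmem (w s)).1 h1
      rw [hf0] at h2
      refine add_nonneg h2 (Finset.sum_nonneg fun j _ => ?_)
      have := hg j hzero_mem (hPmem (w (s - τ j (max s 0)))).1 (hPmem _).1 i
      rwa [hg0] at this
  have hupp : ∀ t, 0 ≤ t → ∀ i, w t i ≤ V i := fun t ht i => by
    have hflip : ∀ s, 0 ≤ s → V i - w s i
        = (V i - φ' 0 i) + rlIntegral (α i) (fun s => -1 * h i s) s := fun s hs => by
      rw [hw s hs i, rlIntegral_const_mul (hα i).1]
      ring
    rw [← sub_nonneg, hflip t ht]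
    refine rlIntegral_solution_nonneg (B := K * ‖V‖ * (1 + m)) (hα i).1 (hα i).2
      (h := fun s => -1 * h i s) (continuous_const.mul (hhc i)) (fun s => ?_) ?_ (fun s hs hle => ?_) ht
    · rw [neg_one_mul, abs_neg]
      exact hhB i s
    · rw [hφ' 0 h0mem, sub_nonneg]
      exact (hφ 0 h0mem).2 i
    · rw [← hflip s hs, sub_nonpos] at hle
      -- Where `w i ≥ V i` the clamped point lies on the upper face and is compared with `V`, at
      -- which the total field is nonpositive.
      have h1 : P (w s) i = V i := by rw [hPi, min_eq_right hle, max_eq_right (show 0 ≤ V i from hV i)]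
      have h2 := hf.apply_le_apply (hPmem (w s)).1 (hPmem (w s)).2 h1
      have h3 : ∑ j, g j (P (w (s - τ j (max s 0)))) i ≤ ∑ j, g j V i :=
        Finset.sum_le_sum fun j _ => hg j (hPmem _).1 hV (hPmem _).2 i
      have h4 : h i s = f (P (w s)) i + ∑ j, g j (P (w (s - τ j (max s 0)))) i := rfl
      rw [h4]
      linarith [hS i]
  have hbox : ∀ t, -r ≤ t → w t ∈ Icc 0 V := fun t ht => by
    rcases le_total t 0 with h' | h'
    · rw [hwh t h', hφ' t ⟨ht, h'⟩]
      exact hφ t ⟨ht, h'⟩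
    · exact ⟨hlow t h', hupp t h'⟩
  have hfield : ∀ i s, 0 ≤ s → h i s = delayField f g τ w i s := fun i s hs => by
    have h1 : ∀ j, -r ≤ s - τ j s := fun j => by linarith [(hτ j s hs).2]
    simp only [hh, delayField, max_eq_left hs, hPid _ (hbox s (by linarith)), hPid _ (hbox _ (h1 _))]
  have hsol : IsDelaySolution α f g τ r φ ⊤ w := by
    refine ⟨hwc.continuousOn, fun s hs => by rw [hwh s hs.2, hφ' s hs], fun t ht _ i => ?_⟩
    have := hasCaputoDerivAt_of_volterra (hα i).1 (hα i).2 (hhc i) (hhB i)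
      (x := fun s => w s i) (fun t ht => hw t ht i) ht
    change HasCaputoDerivAt (α i) (fun s => w s i) (h i t) t at this
    rwa [hfield i t ht.le] at this
  refine ⟨w, ⟨hsol, fun T u hT hu t hrt htT => ?_⟩, fun t ht => hbox t (by linarith)⟩
  rcases le_total t 0 with ht | ht
  · rw [hu.history t ⟨hrt, ht⟩, hsol.history t ⟨hrt, ht⟩]
  -- The competitor `u` need not stay in the box, so uniqueness uses the original fields and their
  -- Lipschitz bounds on every ball.
  have huc : ContinuousOn u (Icc (-r) t) := hu.continuousOn.mono fun s hs =>
    ⟨hs.1, (EReal.coe_le_coe_iff.2 hs.2).trans_lt htT⟩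
  have hdu := continuousOn_delayField hf.continuous hgc hr hτc hτ huc
  have hdw := continuousOn_delayField hf.continuous hgc hr hτc hτ (hwc.continuousOn (s := Icc (-r) t))
  exact volterra_solution_unique hα0 hfL hgL hr ht hτ huc hwc.continuousOn hdu hdw
    (fun s hs i => hu.volterra hα hr htT (hdu i) hs)
    (fun s hs i => hsol.volterra hα hr (EReal.coe_lt_top t) (hdw i) hs)
    (fun s hs => by rw [hu.history s hs, hsol.history s hs]) ⟨ht, le_rfl⟩

/-! ### Weighted norms. -/

section weightedNorm

variable {d : ℕ} {v : Fin d → ℝ}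

theorem abs_le_weightedNorm_mul (hv : ∀ i, 0 < v i) (w : Fin d → ℝ) (i : Fin d) :
    |w i| ≤ weightedNorm v w * v i := by
  rw [← div_le_iff₀ (hv i)]
  exact le_ciSup (f := fun i => |w i| / v i) (Set.finite_range _).bddAbove i

/-- Nonnegativity of `c` covers `d = 0`, where the supremum takes the value `0`. -/
theorem weightedNorm_le (hv : ∀ i, 0 < v i) {w : Fin d → ℝ} {c : ℝ} (hc : 0 ≤ c)
    (hw : ∀ i, |w i| ≤ c * v i) : weightedNorm v w ≤ c :=
  Real.iSup_le (fun i => (div_le_iff₀ (hv i)).2 (hw i)) hc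

theorem weightedNorm_nonneg (hv : ∀ i, 0 < v i) (w : Fin d → ℝ) : 0 ≤ weightedNorm v w :=
  Real.iSup_nonneg fun i => div_nonneg (abs_nonneg _) (hv i).le

theorem historyNorm_nonneg (hv : ∀ i, 0 < v i) (r : ℝ) (φ : ℝ → Fin d → ℝ) :
    0 ≤ historyNorm v r φ :=
  Real.sSup_nonneg fun _ ⟨_, _, h⟩ => h ▸ weightedNorm_nonneg hv _

theorem weightedNorm_le_historyNorm (hv : ∀ i, 0 < v i) {r : ℝ} {φ : ℝ → Fin d → ℝ}
    (hφ : ContinuousOn φ (Icc (-r) 0)) {s : ℝ} (hs : s ∈ Icc (-r) 0) :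
    weightedNorm v (φ s) ≤ historyNorm v r φ := by
  obtain ⟨C, hC⟩ := isCompact_Icc.exists_bound_of_continuousOn hφ
  -- The sum is a crude upper bound for the maximum of the `C / v i`, valid for every `d`.
  refine le_csSup ⟨∑ i, C / v i, ?_⟩ ⟨s, hs, rfl⟩
  rintro _ ⟨s, hs, rfl⟩
  have hC0 : 0 ≤ C := (norm_nonneg _).trans (hC s hs)
  have hnn : ∀ i ∈ Finset.univ, 0 ≤ C / v i := fun i _ => div_nonneg hC0 (hv i).le
  refine Real.iSup_le (fun i => ?_) (Finset.sum_nonneg hnn)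
  refine le_trans ?_ (Finset.single_le_sum hnn (Finset.mem_univ i))
  exact div_le_div_of_nonneg_right ((norm_le_pi_norm _ i).trans (hC s hs)) (hv i).le

end weightedNorm

end FractionalDelay

/-! ### Scaling the stability condition and conclusion. -/

theorem proposition3p1 {d m : ℕ} (hm : 1 ≤ m)
    -- orders of differentiation and delays
    (α : Fin d → ℝ) (hα : ∀ i, 0 < α i ∧ α i ≤ 1)
    (rr : Fin m → ℝ) (hrr : ∀ j, 0 ≤ rr j)
    (r : ℝ) (hr : IsGreatest (Set.range rr) r)
    (τ : Fin m → ℝ → ℝ) (hτc : ∀ j, ContinuousOn (τ j) (Set.Ici 0))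
    (hτ : ∀ j, ∀ t, 0 ≤ t → τ j t ∈ Set.Icc 0 (rr j))
    -- the undelayed vector field
    (f : (Fin d → ℝ) → (Fin d → ℝ)) (p : ℝ) (hp : 1 ≤ p)
    (hf : IsCooperative f) (hfp : IsHomogeneousOfDegree p f)
    -- the delayed vector fields
    (g : Fin m → (Fin d → ℝ) → (Fin d → ℝ)) (q : Fin m → ℝ) (hq : ∀ j, p ≤ q j)
    (hgd : ∀ j, ContDiffOn ℝ 1 (g j) {0}ᶜ)
    (hg : ∀ j, IsOrderPreserving (g j)) (hgq : ∀ j, IsHomogeneousOfDegree (q j) (g j))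
    -- the stability condition
    (v : Fin d → ℝ) (hv : ∀ i, 0 < v i) (hS : ∀ i, f v i + ∑ j, g j v i < 0) :
    ((∃ j, p < q j) →
      ∀ φ : ℝ → Fin d → ℝ, ContinuousOn φ (Set.Icc (-r) 0) →
        (∀ s ∈ Set.Icc (-r) 0, 0 ≤ φ s) → (∀ i, 0 < φ 0 i) → historyNorm v r φ < 1 →
        ∃ w : ℝ → Fin d → ℝ, IsUniqueGlobalSolution α f g τ r φ w ∧
          ∀ t, 0 ≤ t → weightedNorm v (w t) ≤ historyNorm v r φ) ∧
    ((∀ j, q j = p) →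
      ∀ φ : ℝ → Fin d → ℝ, ContinuousOn φ (Set.Icc (-r) 0) →
        (∀ s ∈ Set.Icc (-r) 0, 0 ≤ φ s) → (∀ i, 0 < φ 0 i) →
        ∃ w : ℝ → Fin d → ℝ, IsUniqueGlobalSolution α f g τ r φ w ∧
          ∀ t, 0 ≤ t → weightedNorm v (w t) ≤ historyNorm v r φ) := by
  have hr0 : 0 ≤ r := by
    obtain ⟨j, hj⟩ := hr.1
    exact hj ▸ hrr j
  have hτr : ∀ j t, 0 ≤ t → τ j t ∈ Set.Icc 0 r := fun j t ht =>
    ⟨(hτ j t ht).1, (hτ j t ht).2.trans (hr.2 ⟨j, rfl⟩)⟩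
  have hv0 : (0 : Fin d → ℝ) ≤ v := fun i => (hv i).le
  have hq1 : ∀ j, 1 ≤ q j := fun j => hp.trans (hq j)
  have hgv : ∀ j i, 0 ≤ g j v i := fun j i => by
    have := hg j (show (0 : Fin d → ℝ) ∈ {x | 0 ≤ x} from le_refl (0 : Fin d → ℝ)) hv0 hv0 i
    rwa [(hgq j).map_zero (by linarith [hq1 j])] at this
  have main : ∀ φ : ℝ → Fin d → ℝ, ContinuousOn φ (Set.Icc (-r) 0) →
      (∀ s ∈ Set.Icc (-r) 0, 0 ≤ φ s) →
      (∀ i, f (historyNorm v r φ • v) i + ∑ j, g j (historyNorm v r φ • v) i ≤ 0) →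
      ∃ w : ℝ → Fin d → ℝ, IsUniqueGlobalSolution α f g τ r φ w ∧
        ∀ t, 0 ≤ t → weightedNorm v (w t) ≤ historyNorm v r φ := by
    intro φ hφc hφ hc
    have hc0 := historyNorm_nonneg hv r φ
    obtain ⟨w, hw, hbox⟩ := exists_isUniqueGlobalSolution_mem_box hα hr0 hτc hτr hp hf hfp hq1 hgd
      hg hgq (smul_nonneg hc0 hv0) hc hφc fun s hs => ⟨hφ s hs, fun i =>
        (le_abs_self _).trans ((abs_le_weightedNorm_mul hv (φ s) i).trans
          (mul_le_mul_of_nonneg_right (weightedNorm_le_historyNorm hv hφc hs) (hv i).le))⟩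
    refine ⟨w, hw, fun t ht => weightedNorm_le hv hc0 fun i => ?_⟩
    rw [abs_of_nonneg ((hbox t ht).1 i)]
    exact (hbox t ht).2 i
  have scale : ∀ c : ℝ, 0 ≤ c → (∀ j, 0 < c → c ^ q j ≤ c ^ p) →
      ∀ i, f (c • v) i + ∑ j, g j (c • v) i ≤ 0 := by
    intro c hc hcq i
    -- Homogeneity speaks only of positive factors; for `c = 0` all fields vanish at the origin.
    rcases hc.eq_or_lt with rfl | hc
    · have hg0 : ∀ j, g j 0 = 0 := fun j => (hgq j).map_zero (by linarith [hq1 j])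
      simp [hfp.map_zero (by linarith), hg0]
    have h1 : ∑ j, g j (c • v) i ≤ ∑ j, c ^ p * g j v i := Finset.sum_le_sum fun j _ => by
      rw [hgq j v c hc, Pi.smul_apply, smul_eq_mul]
      exact mul_le_mul_of_nonneg_right (hcq j hc) (hgv j i)
    rw [← Finset.mul_sum] at h1
    rw [hfp v c hc, Pi.smul_apply, smul_eq_mul]
    have := mul_nonpos_of_nonneg_of_nonpos (Real.rpow_nonneg hc.le p) (hS i).le
    linarith
  refine ⟨fun _ φ hφc hφ _ hlt => main φ hφc hφ ?_, fun heq φ hφc hφ _ => main φ hφc hφ ?_⟩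
  · exact scale _ (historyNorm_nonneg hv r φ) fun j hc =>
      Real.rpow_le_rpow_of_exponent_ge hc hlt.le (hq j)
  · exact scale _ (historyNorm_nonneg hv r φ) fun j _ => by rw [heq j]
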